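/- **Theorem 2 (Convergence).** Consider a MIMO multiple-access channel with $K$ users, $n$ transmit antennas per user and $m$ receive antennas. Let $\mathbf H_i\in\mathbb C^{m\times n}$ be the channel matrix of user $i$ and $\mathbf P_i\succcurlyeq\mathbf 0$ the real diagonal matrix of the power budgets of its antennas. Call $(\mathbf Q_1,\dots,\mathbf Q_K)$ feasible if every $\mathbf Q_i\in\mathbb C^{n\times n}$ is Hermitian positive semidefinite with $\mathrm{diag}(\mathbf Q_i)\preccurlyeq\mathbf P_i$. The sum rate is $\log\det\big(\mathbf I_m+\sum_{i=1}^K\mathbf H_i\mathbf Q_i\mathbf H_i^\dagger\big)$, and the sum capacity is its maximum over all feasible tuples. Iterative mode-dropping starts from a feasible tuple (for instance $\mathbf Q_i=\mathbf 0$ for all $i$) and repeats sweeps over $i=1,\dots,K$ indefinitely. The step for user $i$ keeps all the other covariances and replaces $\mathbf Q_i$ by a maximizer of $\log\det(\mathbf I_m+\hat{\mathbf H}_i\mathbf Q\hat{\mathbf H}_i^\dagger)$ over all $\mathbf Q\succcurlyeq\mathbf 0$ with $\mathrm{diag}(\mathbf Q)\preccurlyeq\mathbf P_i$, where $\hat{\mathbf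 H}_i=\big(\mathbf I_m+\sum_{k\ne i}\mathbf H_k\mathbf Q_k\mathbf H_k^\dagger\big)^{-1/2}\mathbf H_i$ is the effective channel formed with the current covariances. Then the sum rate is nondecreasing from each step to the next and converges to the sum capacity, which is attained. If moreover every transmit antenna with a positive power budget has a nonzero channel vector (the corresponding column of $\mathbf H_i$ is not zero), then the sequence of covariance tuples converges, and its limit $(\mathbf Q_1^\ast,\dots,\mathbf Q_K^\ast)$ is feasible and attains the sum capacity. -/

import Mathlib

open Matrix Filter Topology
open scoped ComplexOrder

noncomputable section

/-- A transmit covariance matrix `Q` that is admissible for the per-antenna power budgets `p`: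
`Q` is (Hermitian) positive semidefinite and `diag(Q) ≼ diag(p)`. The diagonal entries of a
positive semidefinite matrix are real, so only their real parts are compared. -/
def IsAdmissible {n : ℕ} (p : Fin n → ℝ) (Q : Matrix (Fin n) (Fin n) ℂ) : Prop :=
  Q.PosSemidef ∧ ∀ j, (Q j j).re ≤ p j

/-- The single-user rate `log det (I + G Q G†)` of a channel matrix `G`, in nats.
For positive semidefinite `Q` the determinant is a positive real number. -/
def rate {m n : ℕ} (G : Matrix (Fin m) (Fin n) ℂ) (Q : Matrix (Fin n) (Fin n) ℂ) : ℝ :=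
  Real.log (1 + G * Q * Gᴴ).det.re

/-- `Q` is an optimal solution of the single-user problem: it maximizes `log det (I + G Q G†)`
among all positive semidefinite `Q` with `diag(Q) ≼ diag(p)`. -/
def IsSingleUserOptimal {m n : ℕ} (G : Matrix (Fin m) (Fin n) ℂ) (p : Fin n → ℝ)
    (Q : Matrix (Fin n) (Fin n) ℂ) : Prop :=
  IsAdmissible p Q ∧ ∀ R, IsAdmissible p R → rate G R ≤ rate G Q

/-- The sum rate `log det (I + ∑ i, H i (Q i) (H i)†)` of the multiple-access channel. -/
def sumRate {K m n : ℕ} (H : Fin K → Matrix (Fin m) (Fin n) ℂ)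
    (Q : Fin K → Matrix (Fin n) (Fin n) ℂ) : ℝ :=
  Real.log (1 + ∑ i, H i * Q i * (H i)ᴴ).det.re

/-- The feasible set of the sum-rate problem: `P i j` is the power budget of antenna `j` of
user `i`. -/
def feasibleSet {K n : ℕ} (P : Fin K → Fin n → ℝ) : Set (Fin K → Matrix (Fin n) (Fin n) ℂ) :=
  {Q | ∀ i, IsAdmissible (P i) (Q i)}

/-- `C` is the sum capacity: the maximum of the sum rate over the feasible set. -/
def IsSumCapacity {K m n : ℕ} (H : Fin K → Matrix (Fin m) (Fin n) ℂ) (P : Fin K → Fin n → ℝ)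
    (C : ℝ) : Prop :=
  IsGreatest (sumRate H '' feasibleSet P) C

/-- `Q` is an optimal solution of the sum-rate maximization problem. -/
def IsSumRateOptimal {K m n : ℕ} (H : Fin K → Matrix (Fin m) (Fin n) ℂ)
    (P : Fin K → Fin n → ℝ) (Q : Fin K → Matrix (Fin n) (Fin n) ℂ) : Prop :=
  Q ∈ feasibleSet P ∧ ∀ R ∈ feasibleSet P, sumRate H R ≤ sumRate H Q

/-- The noise-plus-interference covariance `I + ∑ k ≠ i, H k (Q k) (H k)†` seen by user `i`. -/
def interference {K m n : ℕ} (H : Fin K → Matrix (Fin m) (Fin n) ℂ)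
    (Q : Fin K → Matrix (Fin n) (Fin n) ℂ) (i : Fin K) : Matrix (Fin m) (Fin m) ℂ :=
  1 + ∑ k ∈ Finset.univ.erase i, H k * Q k * (H k)ᴴ

/-- The inverse square root `W ^ (-1/2)` of a (positive definite) Hermitian matrix, by the
continuous functional calculus (i.e. applied to the eigenvalues). -/
def invSqrt {m : ℕ} (W : Matrix (Fin m) (Fin m) ℂ) : Matrix (Fin m) (Fin m) ℂ :=
  cfc (fun x : ℝ => (Real.sqrt x)⁻¹) W

/-- The effective channel `(I + ∑ k ≠ i, H k (Q k) (H k)†) ^ (-1/2) * H i` of user `i`. -/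
def effectiveChannel {K m n : ℕ} (H : Fin K → Matrix (Fin m) (Fin n) ℂ)
    (Q : Fin K → Matrix (Fin n) (Fin n) ℂ) (i : Fin K) : Matrix (Fin m) (Fin n) ℂ :=
  invSqrt (interference H Q i) * H i

/-- One inner step of the algorithm: `Q'` arises from `Q` by replacing the covariance of user `i`
by an optimal solution of the single-user problem for the current effective channel of user `i`,
all the other covariances being kept. -/
def IsUserUpdate {K m n : ℕ} (H : Fin K → Matrix (Fin m) (Fin n) ℂ) (P : Fin K → Fin n → ℝ)
    (i : Fin K) (Q Q' : Fin K → Matrix (Fin n) (Fin n) ℂ) : Prop :=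
  (∀ k, k ≠ i → Q' k = Q k) ∧ IsSingleUserOptimal (effectiveChannel H Q i) (P i) (Q' i)

/-- `X` is a run of iterative mode-dropping: `X t` is the tuple of covariances after `t` inner
steps (each one updating one user), it starts at a feasible tuple (for instance at `0`), and in
the sweep number `s` the users `0, 1, …, K - 1` are updated one after the other. -/
structure IsIterativeModeDropping {K m n : ℕ} (H : Fin K → Matrix (Fin m) (Fin n) ℂ)
    (P : Fin K → Fin n → ℝ) (X : ℕ → Fin K → Matrix (Fin n) (Fin n) ℂ) : Prop where
  init : X 0 ∈ feasibleSet P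
  step : ∀ (s : ℕ) (i : Fin K), IsUserUpdate H P i (X (s * K + i)) (X (s * K + i + 1))

end

/-! The received covariance S(Q) = I + ∑ H_i Q_i H_i† is affine in Q, and log det is strongly
concave on bounded sets of positive definite matrices with bounded inverses. The rate over the
effective channel differs from the sum rate by a constant, so each step is an exact block
maximization. The first-order condition and strong concavity then give an ascent of at least κ‖ΔS‖²
per step (`exists_ascent`).

Let b_s be the length of the path of S in sweep s. Each user's first-order condition holds just
after its own update, and the gradient moves by only O(b_s) until the end of the sweep. By concavity
the gap to any feasible Y is then at most c·b_s·‖Y - Q‖ (`exists_gap_bound`). The ascents are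
summable, so b_s → 0 and the sum rate tends to the capacity.

Convergence of the covariances is harder, because the sum rate need not be strictly concave in Q and
optimal tuples need not be unique. When every antenna with positive budget has a nonzero column,
optimal tuples use full power, so they are cut out of the semidefinite cone by linear equations: the
value of S and the diagonals. Sturm's Hölder error bound for such sets, proved by facial reduction
(`exists_holder_error_bound`), bounds the distance to an optimal tuple by a power of the gap u.
Inserted in the gap bound, this gives the Łojasiewicz-type inequality u_{s+1} ≤ c·b_s·u_{s+1}^γ,
whence ∑ b_s < ∞ (`summable_of_sufficient_decrease`).

A step changes one user only, so every H_i Q_i H_i† converges separately. These limits determine an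
optimal tuple (`eq_of_received_eq`); by compactness the sequence has a single cluster point and
converges. -/

/-! ### Strong concavity of log det -/

section LogDet

open scoped Matrix.Norms.Frobenius

variable {m : ℕ}

/-- The logarithm of the real part of the determinant. -/
noncomputable def logDet (A : Matrix (Fin m) (Fin m) ℂ) : ℝ := Real.log A.det.re

lemma isHermitian_invSqrt (W : Matrix (Fin m) (Fin m) ℂ) : (invSqrt W).IsHermitian :=
  cfc_predicate (R := ℝ) _ W

lemma invSqrt_mul_mul_invSqrt {W : Matrix (Fin m) (Fin m) ℂ} (hW : W.PosDef) :
    invSqrt W * W * invSqrt W = 1 := by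
  have hsa : IsSelfAdjoint W := hW.isHermitian
  have hfin : (spectrum ℝ W).Finite := Matrix.finite_real_spectrum
  have hc : ∀ g : ℝ → ℝ, ContinuousOn g (spectrum ℝ W) := fun g => hfin.continuousOn g
  have h1 : W = cfc (fun x : ℝ => x) W := (cfc_id' ℝ W).symm
  have hpos : ∀ x ∈ spectrum ℝ W, 0 < x := by
    intro x hx
    rw [hW.isHermitian.spectrum_real_eq_range_eigenvalues] at hx
    obtain ⟨i, rfl⟩ := hx
    exact hW.eigenvalues_pos i
  have : invSqrt W * W * invSqrt W
      = cfc (fun x : ℝ => (Real.sqrt x)⁻¹ * x * (Real.sqrt x)⁻¹) W := by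
    rw [cfc_mul _ _ W (hc _) (hc _), cfc_mul _ _ W (hc _) (hc _), ← h1]; rfl
  rw [this, ← cfc_const_one ℝ W]
  apply cfc_congr
  intro x hx
  have h := hpos x hx
  have h2 := Real.sqrt_pos.2 h
  have h3 := Real.mul_self_sqrt h.le
  simp only
  field_simp
  linarith [h3, sq (√x)]

lemma ofReal_det_re {A : Matrix (Fin m) (Fin m) ℂ} (hA : A.PosDef) : ((A.det.re : ℝ) : ℂ) = A.det := by
  have := hA.det_pos
  rw [Complex.lt_def] at this
  apply Complex.ext <;> simp [← this.2]

lemma det_re_pos {A : Matrix (Fin m) (Fin m) ℂ} (hA : A.PosDef) : 0 < A.det.re := by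
  have := hA.det_pos
  rw [Complex.lt_def] at this
  simpa using this.1

lemma logDet_conj {A B L : Matrix (Fin m) (Fin m) ℂ} (hA : A.PosDef) (hB : B.PosDef)
    (hL : L * A * L = 1) : logDet (L * B * L) = logDet B - logDet A := by
  have hA' := det_re_pos hA
  have hB' := det_re_pos hB
  have h1 : L.det * A.det * L.det = 1 := by rw [← det_mul, ← det_mul, hL, det_one]
  have h2 : (L * B * L).det = ((B.det.re / A.det.re : ℝ) : ℂ) := by
    push_cast
    rw [ofReal_det_re hA, ofReal_det_re hB, det_mul, det_mul]
    have : A.det ≠ 0 := hA.det_pos.ne'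
    field_simp
    linear_combination B.det * h1
  rw [logDet, h2, Complex.ofReal_re, Real.log_div hB'.ne' hA'.ne']
  rfl

/-- With x = s², log x ≤ 2(s - 1) = (x - 1) - (s - 1)², while (x - 1)² = (s - 1)²(s + 1)² and (s +
1)² ≤ 2(s² + 1) ≤ 2(ρ + 1). -/
lemma log_le_sub_one_sub_sq {x ρ : ℝ} (hx : 0 < x) (hρ : x ≤ ρ) :
    Real.log x ≤ x - 1 - (x - 1) ^ 2 / (2 * (ρ + 1)) := by
  obtain ⟨s, hs, rfl⟩ : ∃ s : ℝ, 0 < s ∧ s ^ 2 = x := ⟨√x, Real.sqrt_pos.2 hx, Real.sq_sqrt hx.le⟩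
  have h1 : Real.log (s ^ 2) ≤ 2 * (s - 1) := by
    rw [Real.log_pow]; push_cast; linarith [Real.log_le_sub_one_of_pos hs]
  have h2 : (s ^ 2 - 1) ^ 2 / (2 * (ρ + 1)) ≤ (s - 1) ^ 2 := by
    rw [div_le_iff₀ (by nlinarith)]
    have : (s ^ 2 - 1) ^ 2 = (s - 1) ^ 2 * (s + 1) ^ 2 := by ring
    rw [this]
    apply mul_le_mul_of_nonneg_left _ (sq_nonneg _)
    nlinarith [sq_nonneg (s - 1)]
  nlinarith

lemma norm_sq_eq_sum {m n : Type*} [Fintype m] [Fintype n] (A : Matrix m n ℂ) :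
    ‖A‖ ^ 2 = ∑ i, ∑ j, ‖A i j‖ ^ 2 := by
  have : 0 ≤ ∑ i, ∑ j, ‖A i j‖ ^ (2:ℝ) := by positivity
  rw [frobenius_norm_def, ← Real.sqrt_eq_rpow, Real.sq_sqrt this]
  norm_num

lemma norm_entry_le {m n : Type*} [Fintype m] [Fintype n] (A : Matrix m n ℂ) (i : m) (j : n) :
    ‖A i j‖ ≤ ‖A‖ := by
  apply le_of_sq_le_sq _ (norm_nonneg _)
  rw [norm_sq_eq_sum]
  refine le_trans ?_ (Finset.single_le_sum (f := fun i => ∑ j, ‖A i j‖ ^ 2)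
    (fun _ _ => by positivity) (Finset.mem_univ i))
  exact Finset.single_le_sum (f := fun j => ‖A i j‖ ^ 2) (fun _ _ => by positivity) (Finset.mem_univ j)

lemma frobenius_norm_sq {m n : Type*} [Fintype m] [Fintype n] (A : Matrix m n ℂ) :
    ‖A‖ ^ 2 = (A * Aᴴ).trace.re := by
  rw [norm_sq_eq_sum]
  simp only [trace, diag_apply, mul_apply, conjTranspose_apply, Complex.re_sum]
  refine Finset.sum_congr rfl fun i _ => Finset.sum_congr rfl fun j _ => ?_
  rw [RCLike.star_def, Complex.mul_conj, Complex.ofReal_re, Complex.normSq_eq_norm_sq]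

lemma abs_trace_re_le {ι : Type*} [Fintype ι] (A : Matrix ι ι ℂ) :
    |A.trace.re| ≤ Fintype.card ι * ‖A‖ :=
  calc |A.trace.re| ≤ ‖A.trace‖ := Complex.abs_re_le_norm _
    _ ≤ ∑ i, ‖A i i‖ := norm_sum_le _ _
    _ ≤ ∑ _i : ι, ‖A‖ := Finset.sum_le_sum fun i _ => norm_entry_le A i i
    _ = Fintype.card ι * ‖A‖ := by simp

lemma abs_trace_mul_re_le (A B : Matrix (Fin m) (Fin m) ℂ) :
    |(A * B).trace.re| ≤ m * (‖A‖ * ‖B‖) :=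
  (abs_trace_re_le _).trans (by rw [Fintype.card_fin]; gcongr; exact frobenius_norm_mul A B)

lemma sum_eigenvalues_sq {ι : Type*} [Fintype ι] [DecidableEq ι] {M : Matrix ι ι ℂ}
    (hM : M.IsHermitian) : ∑ i, hM.eigenvalues i ^ 2 = ‖M‖ ^ 2 := by
  have hsp : M * M = (Unitary.conjStarAlgAut ℂ (Matrix ι ι ℂ)) hM.eigenvectorUnitary
      (diagonal fun i => (((hM.eigenvalues i) ^ 2 : ℝ) : ℂ)) := by
    conv_lhs => rw [hM.spectral_theorem]
    rw [← map_mul, diagonal_mul_diagonal]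
    congr 2; ext i; simp [sq]
  rw [frobenius_norm_sq, hM.eq, hsp, Unitary.conjStarAlgAut_apply, trace_mul_cycle,
    Unitary.coe_star_mul_self, one_mul, trace_diagonal, ← Complex.ofReal_sum, Complex.ofReal_re]

/-- For a positive definite `M`, `log det M ≤ tr (M - 1) - ‖M - 1‖² / (2 (tr M + 1))`. -/
lemma logDet_le_trace_sub {M : Matrix (Fin m) (Fin m) ℂ} (hM : M.PosDef) :
    logDet M ≤ (M - 1).trace.re - ‖M - 1‖ ^ 2 / (2 * (M.trace.re + 1)) := by
  set ev := hM.isHermitian.eigenvalues with hev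
  have hpos : ∀ i, 0 < ev i := hM.eigenvalues_pos
  have htr : M.trace.re = ∑ i, ev i := by
    rw [hM.isHermitian.trace_eq_sum_eigenvalues]; simp [hev]
  have hdet : M.det.re = ∏ i, ev i := by
    rw [hM.isHermitian.det_eq_prod_eigenvalues]
    have : (∏ i, ((hM.isHermitian.eigenvalues i : ℝ) : ℂ)) = ((∏ i, ev i : ℝ) : ℂ) := by
      push_cast; rfl
    exact (congrArg Complex.re this).trans (Complex.ofReal_re _)
  have htr2 : (M * M).trace.re = ∑ i, ev i ^ 2 := by
    rw [hev, sum_eigenvalues_sq, frobenius_norm_sq, hM.isHermitian.eq]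
  have hnorm : ‖M - 1‖ ^ 2 = ∑ i, (ev i - 1) ^ 2 := by
    rw [frobenius_norm_sq, conjTranspose_sub, hM.isHermitian.eq, conjTranspose_one]
    have : (M - 1) * (M - 1) = M * M - M - M + 1 := by noncomm_ring
    rw [this]
    simp only [trace_add, trace_sub, Complex.add_re, Complex.sub_re, htr2, htr, trace_one]
    simp only [sub_sq, Finset.sum_add_distrib, Finset.sum_sub_distrib]
    simp
    rw [← Finset.mul_sum]; ring
  -- The trace bounds every eigenvalue, so ρ = tr M serves in the scalar inequality for all of them.
  have hle : ∀ i, ev i ≤ M.trace.re := fun i => by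
    rw [htr]; exact Finset.single_le_sum (fun j _ => (hpos j).le) (Finset.mem_univ i)
  rw [logDet, hdet, Real.log_prod (fun i _ => (hpos i).ne'), hnorm]
  calc ∑ i, Real.log (ev i) ≤ ∑ i, (ev i - 1 - (ev i - 1) ^ 2 / (2 * (M.trace.re + 1))) :=
        Finset.sum_le_sum fun i _ => log_le_sub_one_sub_sq (hpos i) (hle i)
    _ = _ := by
        rw [Finset.sum_sub_distrib, Finset.sum_div, trace_sub, Complex.sub_re, htr]
        simp

/-- Strong concavity of `log det` on bounded sets of positive definite matrices. -/
lemma logDet_le_of_bounded {A B : Matrix (Fin m) (Fin m) ℂ} {b : ℝ} (hA : A.PosDef) (hB : B.PosDef)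
    (hAb : ‖A‖ ≤ b) (hAb' : ‖A⁻¹‖ ≤ b) (hBb : ‖B‖ ≤ b) :
    logDet B ≤ logDet A + (A⁻¹ * (B - A)).trace.re
      - ‖B - A‖ ^ 2 / (2 * (m * b ^ 2 + 1) * ((m * b) ^ 2 + 1)) := by
  have hb : 0 ≤ b := (norm_nonneg _).trans hAb
  -- Whitening by L = A^(-1/2) moves the base point to the identity, where the trace inequality
  -- applies to M = L B L.
  set L := invSqrt A with hLdef
  have hL : L.IsHermitian := isHermitian_invSqrt A
  have hLAL : L * A * L = 1 := invSqrt_mul_mul_invSqrt hA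
  have hLu : IsUnit L := IsUnit.of_mul_eq_one (L * A) (mul_eq_one_comm.1 hLAL)
  have hM : (L * B * L).PosDef := by
    have := (IsUnit.posDef_star_left_conjugate_iff (U := L) (x := B) hLu).2 hB
    rwa [star_eq_conjTranspose, hL.eq] at this
  have hLL : L * L = A⁻¹ := by
    symm; apply inv_eq_left_inv
    rw [mul_assoc]
    exact mul_eq_one_comm.1 hLAL
  have hkey := logDet_le_trace_sub hM
  rw [logDet_conj hA hB hLAL] at hkey
  have e1 : (L * B * L - 1) = L * (B - A) * L := by rw [mul_sub, sub_mul, hLAL]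
  have e2 : (L * B * L - 1).trace = (A⁻¹ * (B - A)).trace := by
    rw [e1, trace_mul_comm, ← mul_assoc, hLL]
  have e3 : (L * B * L).trace = (A⁻¹ * B).trace := by
    rw [trace_mul_comm, ← mul_assoc, hLL]
  rw [e2] at hkey
  have htr : (L * B * L).trace.re ≤ m * b ^ 2 := by
    rw [e3]
    refine (le_abs_self _).trans ((abs_trace_mul_re_le _ _).trans ?_)
    rw [sq]; gcongr
  have htr0 : 0 ≤ (L * B * L).trace.re := by
    have := hM.posSemidef.trace_nonneg
    rw [Complex.le_def] at this
    simpa using this.1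
  have hdet : IsUnit A.det := (isUnit_iff_isUnit_det A).1 hA.isUnit
  have h1 : A * L * L = 1 := by rw [mul_assoc, hLL]; exact mul_nonsing_inv _ hdet
  have h2 : L * (L * A) = 1 := by rw [← mul_assoc, hLL]; exact nonsing_inv_mul _ hdet
  -- Undoing the whitening costs only ‖A L‖² = tr A ≤ m b; this is the source of the factor (m b)²,
  -- and the added 1 keeps the denominator positive.
  have hdiff : B - A = (A * L) * (L * B * L - 1) * (L * A) := by
    rw [e1]
    calc B - A = (A * L * L) * (B - A) * (L * (L * A)) := by rw [h1, h2]; simp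
      _ = _ := by simp only [mul_assoc]
  have hconj : (A * L)ᴴ = L * A := by rw [conjTranspose_mul, hL.eq, hA.isHermitian.eq]
  have hAL : ‖A * L‖ ^ 2 ≤ m * b := by
    rw [frobenius_norm_sq, hconj, ← mul_assoc, h1, one_mul]
    refine (le_abs_self _).trans ((abs_trace_re_le _).trans ?_)
    rw [Fintype.card_fin]; gcongr
  have hLA : ‖L * A‖ = ‖A * L‖ := by rw [← hconj, frobenius_norm_conjTranspose]
  have hle : ‖B - A‖ ≤ ‖A * L‖ ^ 2 * ‖L * B * L - 1‖ := by
    rw [hdiff]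
    calc _ ≤ ‖A * L * (L * B * L - 1)‖ * ‖L * A‖ := frobenius_norm_mul _ _
      _ ≤ (‖A * L‖ * ‖L * B * L - 1‖) * ‖L * A‖ := by gcongr; exact frobenius_norm_mul _ _
      _ = _ := by rw [hLA]; ring
  have hsq : ‖B - A‖ ^ 2 ≤ ((m * b) ^ 2 + 1) * ‖L * B * L - 1‖ ^ 2 := by
    calc ‖B - A‖ ^ 2 ≤ (m * b * ‖L * B * L - 1‖) ^ 2 := by
          gcongr; exact hle.trans (by gcongr)
      _ ≤ _ := by nlinarith [sq_nonneg ‖L * B * L - 1‖]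
  have : ‖B - A‖ ^ 2 / (2 * (m * b ^ 2 + 1) * ((m * b) ^ 2 + 1))
      ≤ ‖L * B * L - 1‖ ^ 2 / (2 * ((L * B * L).trace.re + 1)) := by
    rw [div_le_div_iff₀ (by positivity) (by positivity)]
    calc ‖B - A‖ ^ 2 * (2 * ((L * B * L).trace.re + 1))
        ≤ (((m * b) ^ 2 + 1) * ‖L * B * L - 1‖ ^ 2) * (2 * (m * b ^ 2 + 1)) := by gcongr
      _ = _ := by ring
  linarith

end LogDet

/-! ### Hölder error bounds for spectrahedra -/

section ErrorBound

open scoped Matrix.Norms.Frobenius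

variable {ι : Type*}

/-- The principal minor on the indices k, j is nonnegative. -/
lemma norm_entry_sq_le {W : Matrix ι ι ℂ} (hW : W.PosSemidef) (k j : ι) :
    ‖W k j‖ ^ 2 ≤ (W k k).re * (W j j).re := by
  have h := (hW.submatrix ![k, j]).det_nonneg
  rw [det_fin_two] at h
  simp only [submatrix_apply, cons_val_zero, cons_val_one] at h
  have e : W j k = star (W k j) := (hW.isHermitian.apply j k).symm
  rw [e, RCLike.star_def, Complex.mul_conj, Complex.normSq_eq_norm_sq, Complex.le_def] at h
  have h1 : (W k k).im = 0 := by
    have := (hW.isHermitian.coe_re_apply_self k).symm; rw [this]; simp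
  have h2 : (W j j).im = 0 := by
    have := (hW.isHermitian.coe_re_apply_self j).symm; rw [this]; simp
  have := h.1
  simp only [Complex.sub_re, Complex.mul_re, h1, h2, Complex.zero_re, Complex.ofReal_re] at this
  linarith

lemma diag_re_nonneg {W : Matrix ι ι ℂ} (hW : W.PosSemidef) (k : ι) : 0 ≤ (W k k).re := by
  have := hW.diag_nonneg (i := k)
  rw [Complex.le_def] at this
  exact this.1

variable [Fintype ι]

/-- A positive semidefinite matrix is bounded in norm by its trace. -/
lemma norm_le_trace {W : Matrix ι ι ℂ} (hW : W.PosSemidef) : ‖W‖ ≤ W.trace.re := by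
  have h0 : 0 ≤ W.trace.re := by
    simp only [trace, diag_apply, Complex.re_sum]
    exact Finset.sum_nonneg fun i _ => diag_re_nonneg hW i
  apply le_of_sq_le_sq _ h0
  rw [norm_sq_eq_sum]
  calc ∑ i, ∑ j, ‖W i j‖ ^ 2 ≤ ∑ i, ∑ j, (W i i).re * (W j j).re :=
        Finset.sum_le_sum fun i _ => Finset.sum_le_sum fun j _ => norm_entry_sq_le hW i j
    _ = W.trace.re ^ 2 := by
        simp only [trace, diag_apply, Complex.re_sum, sq, Finset.sum_mul_sum]

variable [DecidableEq ι]

lemma add_smul_one_eq {E : Matrix ι ι ℂ} (hE : E.IsHermitian) (c : ℝ) :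
    E + (c : ℂ) • 1 = (hE.eigenvectorUnitary : Matrix ι ι ℂ) *
      diagonal (fun i => ((hE.eigenvalues i + c : ℝ) : ℂ)) * (hE.eigenvectorUnitary : Matrix ι ι ℂ)ᴴ := by
  have h1 : diagonal (fun i => ((hE.eigenvalues i + c : ℝ) : ℂ))
      = diagonal (RCLike.ofReal ∘ hE.eigenvalues) + (c : ℂ) • (1 : Matrix ι ι ℂ) := by
    rw [smul_one_eq_diagonal, diagonal_add]; congr 1; ext i; simp
  have h2 := hE.spectral_theorem
  rw [Unitary.conjStarAlgAut_apply] at h2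
  rw [h1, mul_add, add_mul]
  have h3 : (hE.eigenvectorUnitary : Matrix ι ι ℂ) * (hE.eigenvectorUnitary : Matrix ι ι ℂ)ᴴ = 1 :=
    Unitary.coe_mul_star_self hE.eigenvectorUnitary
  congr 1
  rw [mul_smul_one, smul_mul_assoc, h3]

lemma posSemidef_add_smul_one {E : Matrix ι ι ℂ} (hE : E.IsHermitian) {c : ℝ}
    (hc : ∀ i, 0 ≤ hE.eigenvalues i + c) : (E + (c : ℂ) • 1).PosSemidef := by
  rw [add_smul_one_eq hE]
  apply PosSemidef.mul_mul_conjTranspose_same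
  apply PosSemidef.diagonal
  intro i
  simpa using (by exact_mod_cast hc i : (0 : ℂ) ≤ ((hE.eigenvalues i + c : ℝ) : ℂ))

lemma posSemidef_add_norm_smul_one {E : Matrix ι ι ℂ} (hE : E.IsHermitian) :
    (E + ((‖E‖ : ℝ) : ℂ) • 1).PosSemidef := by
  apply posSemidef_add_smul_one hE
  intro i
  have h1 : hE.eigenvalues i ^ 2 ≤ ‖E‖ ^ 2 := by
    rw [← sum_eigenvalues_sq hE]
    exact Finset.single_le_sum (f := fun i => hE.eigenvalues i ^ 2) (fun _ _ => sq_nonneg _)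
      (Finset.mem_univ i)
  linarith [abs_le_of_sq_le_sq' h1 (norm_nonneg E)]

lemma exists_pos_posSemidef_sub {Q : Matrix ι ι ℂ} (hQ : Q.PosDef) :
    ∃ δ : ℝ, 0 < δ ∧ (Q - (δ : ℂ) • 1).PosSemidef := by
  have : ∃ δ : ℝ, 0 < δ ∧ ∀ i, δ ≤ hQ.isHermitian.eigenvalues i := by
    rcases isEmpty_or_nonempty ι with h | h
    · exact ⟨1, one_pos, fun i => h.elim i⟩
    · obtain ⟨i, hi⟩ := Finite.exists_min hQ.isHermitian.eigenvalues
      exact ⟨_, hQ.eigenvalues_pos i, hi⟩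
  obtain ⟨δ, h0, h⟩ := this
  refine ⟨δ, h0, ?_⟩
  have := posSemidef_add_smul_one hQ.isHermitian (c := -δ) (fun i => by linarith [h i])
  simpa [sub_eq_add_neg] using this

omit [Fintype ι] in
lemma posDef_smul_one {c : ℝ} (hc : 0 < c) : ((c : ℂ) • (1 : Matrix ι ι ℂ)).PosDef :=
  PosDef.one.smul (by exact_mod_cast hc)

omit [Fintype ι] [DecidableEq ι] in
lemma posSemidef_real_smul {Q : Matrix ι ι ℂ} (hQ : Q.PosSemidef) {c : ℝ} (hc : 0 ≤ c) :
    (c • Q).PosSemidef := hQ.smul hc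

/-- The real-linear projection onto the Hermitian part. -/
noncomputable def hermPart (ι : Type*) : Matrix ι ι ℂ →ₗ[ℝ] Matrix ι ι ℂ where
  toFun X := (1 / 2 : ℝ) • (X + Xᴴ)
  map_add' X Y := by rw [conjTranspose_add, ← smul_add]; congr 1; abel
  map_smul' c X := by
    simp only [conjTranspose_smul, star_trivial, RingHom.id_apply, ← smul_add]
    rw [smul_comm]

omit [Fintype ι] [DecidableEq ι] in
lemma hermPart_apply (X : Matrix ι ι ℂ) : hermPart ι X = (1 / 2 : ℝ) • (X + Xᴴ) := rfl

omit [Fintype ι] [DecidableEq ι] in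
lemma isHermitian_hermPart (X : Matrix ι ι ℂ) : (hermPart ι X).IsHermitian := by
  rw [hermPart_apply, IsHermitian, conjTranspose_smul, conjTranspose_add, conjTranspose_conjTranspose,
    add_comm, star_trivial]

omit [Fintype ι] [DecidableEq ι] in
lemma hermPart_of_isHermitian {X : Matrix ι ι ℂ} (hX : X.IsHermitian) : hermPart ι X = X := by
  rw [hermPart_apply, hX.eq, ← two_smul ℝ X, smul_smul]; norm_num

/-- Positive definite matrices are Hermitian and in general not open among all complex matrices.
Their preimage under the Hermitian part is open, as Hahn–Banach separation requires: a perturbation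
smaller than the least eigenvalue is harmless. -/
lemma isOpen_posDef_hermPart : IsOpen {X : Matrix ι ι ℂ | (hermPart ι X).PosDef} := by
  refine Metric.isOpen_iff.2 fun X hX => ?_
  obtain ⟨δ, hδ, hδ'⟩ := exists_pos_posSemidef_sub hX
  refine ⟨δ, hδ, fun Y hY => ?_⟩
  set E := hermPart ι (Y - X)
  have hE : E.IsHermitian := isHermitian_hermPart _
  have hn : ‖E‖ < δ := by
    have : ‖E‖ ≤ ‖Y - X‖ := by
      simp only [E, hermPart_apply, norm_smul]
      have := norm_add_le (Y - X) (Y - X)ᴴ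
      rw [frobenius_norm_conjTranspose] at this
      rw [Real.norm_of_nonneg (by norm_num)]; linarith
    exact this.trans_lt (by simpa [dist_eq_norm] using hY)
  have e : hermPart ι Y = ((hermPart ι X - (δ : ℂ) • 1) + (E + ((‖E‖ : ℝ) : ℂ) • 1))
      + ((δ - ‖E‖ : ℝ) : ℂ) • 1 := by
    have : hermPart ι Y = hermPart ι X + E := by rw [← map_add]; simp
    rw [this]; push_cast; rw [sub_smul]; abel
  show (hermPart ι Y).PosDef
  rw [e]
  exact PosDef.posSemidef_add (hδ'.add (posSemidef_add_norm_smul_one hE))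
    (posDef_smul_one (by linarith))

lemma LinearMap.exists_pos_bound {F G : Type*} [NormedAddCommGroup F] [NormedSpace ℝ F]
    [FiniteDimensional ℝ F] [NormedAddCommGroup G] [NormedSpace ℝ G] (f : F →ₗ[ℝ] G) :
    ∃ C : ℝ, 0 < C ∧ ∀ x, ‖f x‖ ≤ C * ‖x‖ :=
  SemilinearMapClass.bound_of_continuous f (LinearMap.continuous_of_finiteDimensional f)

/-- A linear map on Hermitian matrices has a bounded right inverse on its range. -/
lemma exists_bounded_hermitian_preimage {F : Type*} [NormedAddCommGroup F] [NormedSpace ℝ F]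
    (A : Matrix ι ι ℂ →ₗ[ℝ] F) :
    ∃ c : ℝ, 0 ≤ c ∧ ∀ X : Matrix ι ι ℂ, X.IsHermitian →
      ∃ E : Matrix ι ι ℂ, E.IsHermitian ∧ A E = A X ∧ ‖E‖ ≤ c * ‖A X‖ := by
  set T := A ∘ₗ hermPart ι
  obtain ⟨B, hB⟩ := T.rangeRestrict.exists_rightInverse_of_surjective (LinearMap.range_rangeRestrict T)
  obtain ⟨c, hc, hcB⟩ := (hermPart ι ∘ₗ B).exists_pos_bound
  refine ⟨c, hc.le, fun X hX => ?_⟩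
  have hTX : T X = A X := by simp [T, hermPart_of_isHermitian hX]
  refine ⟨hermPart ι (B ⟨T X, X, rfl⟩), isHermitian_hermPart _, ?_, ?_⟩
  · have := congrArg Subtype.val (LinearMap.congr_fun hB ⟨T X, X, rfl⟩)
    exact this.trans hTX
  · have := hcB ⟨T X, X, rfl⟩
    rw [← hTX]; exact this

/-- Error bound for a spectrahedron that contains a positive definite matrix. -/
lemma exists_near_of_posDef {F : Type*} [NormedAddCommGroup F] [NormedSpace ℝ F]
    (A : Matrix ι ι ℂ →ₗ[ℝ] F) {P : Matrix ι ι ℂ} (hP : P.PosDef) (R : ℝ) :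
    ∃ C : ℝ, ∀ Q : Matrix ι ι ℂ, Q.PosSemidef → ‖Q‖ ≤ R →
      ∃ Q' : Matrix ι ι ℂ, Q'.PosSemidef ∧ A Q' = A P ∧ ‖Q - Q'‖ ≤ C * ‖A Q - A P‖ := by
  obtain ⟨c, hc, hcA⟩ := exists_bounded_hermitian_preimage A
  obtain ⟨δ, hδ, hδP⟩ := exists_pos_posSemidef_sub hP
  refine ⟨(2 + (‖P‖ + R) / δ) * c, fun Q hQ hQR => ?_⟩
  obtain ⟨E, hE, hAE, hEn⟩ := hcA (P - Q) (hP.isHermitian.sub hQ.isHermitian)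
  -- `Q + E` solves the linear system but may miss semidefiniteness by up to ‖E‖. Mixing in `P`,
  -- which has margin δ, repairs this as soon as sδ = (1 - s)‖E‖.
  set s : ℝ := ‖E‖ / (δ + ‖E‖) with hs
  have hE0 := norm_nonneg E
  have hs0 : 0 ≤ s := by positivity
  have hs1 : 0 ≤ 1 - s := by
    rw [hs, sub_nonneg, div_le_one (by positivity)]; linarith
  have hbal : s * δ = (1 - s) * ‖E‖ := by rw [hs]; field_simp; ring
  have hid : (1 - s) • (Q + E) + s • P
      = (1 - s) • Q + (1 - s) • (E + ((‖E‖ : ℝ) : ℂ) • 1) + s • (P - (δ : ℂ) • 1) := by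
    have : (1 - s) • ((‖E‖ : ℝ) : ℂ) • (1 : Matrix ι ι ℂ) = s • (δ : ℂ) • (1 : Matrix ι ι ℂ) := by
      rw [Complex.coe_smul, Complex.coe_smul, smul_smul, smul_smul, hbal]
    rw [smul_add, smul_add, smul_sub, this]; abel
  refine ⟨(1 - s) • (Q + E) + s • P, ?_, ?_, ?_⟩
  · rw [hid]
    exact ((posSemidef_real_smul hQ hs1).add
      (posSemidef_real_smul (posSemidef_add_norm_smul_one hE) hs1)).add (posSemidef_real_smul hδP hs0)
  · rw [map_add, map_smul, map_smul, map_add, hAE, map_sub, add_sub_cancel, ← add_smul]; simp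
  · have hEn' : ‖E‖ ≤ c * ‖A Q - A P‖ := by rwa [map_sub, norm_sub_rev] at hEn
    have hsE : s ≤ ‖E‖ / δ := by
      rw [hs]; apply div_le_div_of_nonneg_left hE0 hδ; linarith
    have e : Q - ((1 - s) • (Q + E) + s • P) = -((1 - s) • E) + s • (Q - P) := by
      module
    rw [e]
    calc ‖-((1 - s) • E) + s • (Q - P)‖ ≤ (1 - s) * ‖E‖ + s * (‖Q‖ + ‖P‖) := by
          refine (norm_add_le _ _).trans ?_
          rw [norm_neg, norm_smul, norm_smul, Real.norm_of_nonneg hs1, Real.norm_of_nonneg hs0]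
          gcongr; exact norm_sub_le _ _
      _ ≤ 2 * ‖E‖ + ‖E‖ / δ * (R + ‖P‖) := by
          gcongr; linarith
      _ = (2 + (‖P‖ + R) / δ) * ‖E‖ := by field_simp; ring
      _ ≤ (2 + (‖P‖ + R) / δ) * (c * ‖A Q - A P‖) := by
          have : 0 ≤ R := (norm_nonneg _).trans hQR
          gcongr
      _ = _ := by ring

/-- If a spectrahedron contains no positive definite matrix, there is an exposing functional. -/
lemma exists_exposing_functional {F : Type*} [NormedAddCommGroup F] [NormedSpace ℝ F]
    (A : Matrix ι ι ℂ →ₗ[ℝ] F) {P : Matrix ι ι ℂ} (hP : P.PosSemidef)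
    (hA : ∀ X : Matrix ι ι ℂ, X.PosDef → A X ≠ A P) :
    ∃ g : Matrix ι ι ℂ →ₗ[ℝ] ℝ, (∀ X, X.PosSemidef → 0 ≤ g X) ∧ 0 < g 1 ∧
      ∃ c : ℝ, 0 ≤ c ∧ ∀ X, X.IsHermitian → |g X| ≤ c * ‖A X - A P‖ := by
  set T := A ∘ₗ hermPart ι
  have hTherm : ∀ {X}, X.IsHermitian → T X = A X := fun hX => by simp [T, hermPart_of_isHermitian hX]
  have hconv : Convex ℝ {X : Matrix ι ι ℂ | (hermPart ι X).PosDef} := by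
    rw [convex_iff_forall_pos]
    intro X hX Y hY a b ha hb _
    show (hermPart ι (a • X + b • Y)).PosDef
    rw [map_add, map_smul, map_smul]
    exact PosDef.add (PosDef.smul hX ha) (PosDef.smul hY hb)
  have hconv' : Convex ℝ {X : Matrix ι ι ℂ | T X = A P} := by
    intro X hX Y hY a b _ _ hab
    show T (a • X + b • Y) = A P
    rw [map_add, map_smul, map_smul, hX, hY, ← add_smul, hab, one_smul]
  have hdisj : Disjoint {X : Matrix ι ι ℂ | (hermPart ι X).PosDef} {X | T X = A P} := by
    rw [Set.disjoint_left]
    intro X hX hX'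
    exact hA _ hX hX'
  -- Scaling within the cone turns the separation into f ≤ 0 on semidefinite matrices and u ≥ 0.
  -- Since `P` lies in both the closed cone and the affine set, f P = 0.
  obtain ⟨f, u, hf, hu⟩ := geometric_hahn_banach_open hconv isOpen_posDef_hermPart hconv' hdisj
  have hpd : ∀ X : Matrix ι ι ℂ, X.PosDef → f X < u := fun X hX =>
    hf X (by simpa [hermPart_of_isHermitian hX.isHermitian] using hX)
  have hcone : ∀ X : Matrix ι ι ℂ, X.PosDef → f X ≤ 0 := by
    intro X hX
    by_contra hcon
    push Not at hcon
    have h := hpd (((|u| + 1) / f X) • X) (PosDef.smul hX (by positivity))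
    rw [map_smul, smul_eq_mul, div_mul_cancel₀ _ hcon.ne'] at h
    linarith [le_abs_self u]
  have hu0 : 0 ≤ u := by
    by_contra hcon
    push Not at hcon
    have h1 := hpd 1 PosDef.one
    have h := hpd ((u / (2 * f 1)) • 1) (PosDef.smul PosDef.one
      (div_pos_of_neg_of_neg hcon (by linarith)))
    have e : u / (2 * f 1) * f 1 = u / 2 := by
      have : f 1 ≠ 0 := by linarith
      field_simp
    rw [map_smul, smul_eq_mul, e] at h
    linarith
  have hpsd : ∀ X : Matrix ι ι ℂ, X.PosSemidef → f X ≤ 0 := by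
    intro X hX
    have h1 := hcone 1 PosDef.one
    by_contra hcon
    push Not at hcon
    have h := hcone (X + (f X / (2 * (1 - f 1))) • 1) (PosDef.posSemidef_add hX
      (PosDef.smul PosDef.one (div_pos hcon (by linarith))))
    have e : f X + f X / (2 * (1 - f 1)) * f 1 = f X * (2 - f 1) / (2 * (1 - f 1)) := by
      have : 1 - f 1 ≠ 0 := by linarith
      field_simp; ring
    rw [map_add, map_smul, smul_eq_mul, e] at h
    have : 0 < f X * (2 - f 1) / (2 * (1 - f 1)) :=
      div_pos (mul_pos hcon (by linarith)) (by linarith)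
    linarith
  have hP0 : f P = 0 := le_antisymm (hpsd P hP) (hu0.trans (hu P (hTherm hP.isHermitian)))
  -- Both `P + X` and `P - X` stay in the affine set, where f ≥ u ≥ 0. Hence f depends on `T X`
  -- alone, and the residual controls it.
  have hker : ∀ X, T X = 0 → f X = 0 := by
    intro X hX
    have h1 := hu (P + X) (by show T (P + X) = A P; rw [map_add, hX, add_zero, hTherm hP.isHermitian])
    have h2 := hu (P - X) (by show T (P - X) = A P; rw [map_sub, hX, sub_zero, hTherm hP.isHermitian])
    rw [map_add] at h1
    rw [map_sub] at h2
    linarith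
  obtain ⟨c, hc, hcA⟩ := exists_bounded_hermitian_preimage A
  obtain ⟨d, hd, hdf⟩ := (f : Matrix ι ι ℂ →ₗ[ℝ] ℝ).exists_pos_bound
  refine ⟨-(f : Matrix ι ι ℂ →ₗ[ℝ] ℝ), fun X hX => by simpa using hpsd X hX, ?_, d * c,
    by positivity, fun X hX => ?_⟩
  · have := hpd 1 PosDef.one
    have := hu P (hTherm hP.isHermitian)
    simp; linarith
  · obtain ⟨E, hE, hAE, hEn⟩ := hcA (X - P) (hX.sub hP.isHermitian)
    have h := hker (X - P - E) (by
      rw [map_sub, hTherm (hX.sub hP.isHermitian), hTherm hE, hAE, sub_self])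
    rw [map_sub, map_sub, hP0] at h
    have hfX : f X = f E := by linarith
    rw [LinearMap.neg_apply, abs_neg]
    show |f X| ≤ _
    rw [hfX, ← map_sub]
    calc |f E| ≤ d * ‖E‖ := hdf E
      _ ≤ d * (c * ‖A (X - P)‖) := by gcongr
      _ = _ := by ring

/-- A nonnegative functional on positive semidefinite matrices that is not zero dominates a
multiple of some diagonal entry in a suitable orthonormal basis. -/
lemma exists_unitary_diag_le {g : Matrix ι ι ℂ →ₗ[ℝ] ℝ} (hg : ∀ X, X.PosSemidef → 0 ≤ g X)
    (hg1 : 0 < g 1) :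
    ∃ (U : Matrix.unitaryGroup ι ℂ) (k : ι) (c : ℝ), 0 < c ∧ ∀ X : Matrix ι ι ℂ, X.PosSemidef →
      c * (((U : Matrix ι ι ℂ)ᴴ * X * (U : Matrix ι ι ℂ)) k k).re ≤ g X := by
  -- The matrix that represents the real-linear g as X ↦ Re tr(Z X).
  set Z : Matrix ι ι ℂ := fun j i => (g (single i j 1) : ℂ) - Complex.I * g (single i j Complex.I)
    with hZ
  have hgZ : ∀ X, g X = (Z * X).trace.re := by
    intro X
    conv_lhs => rw [matrix_eq_sum_single X]
    rw [trace_mul_comm]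
    simp only [map_sum, trace, diag_apply, mul_apply, Complex.re_sum]
    refine Finset.sum_congr rfl fun i _ => Finset.sum_congr rfl fun j _ => ?_
    have : single i j (X i j) = (X i j).re • single i j (1 : ℂ) + (X i j).im • single i j Complex.I := by
      rw [smul_single, smul_single, ← single_add]
      congr 1
      simp [Complex.re_add_im]
    rw [this, map_add, map_smul, map_smul]
    simp [hZ]
  set W := hermPart ι Z
  have hW : W.IsHermitian := isHermitian_hermPart Z
  have hgW : ∀ X, X.IsHermitian → g X = (W * X).trace.re := by
    intro X hX
    have h1 : (Zᴴ * X).trace.re = (Z * X).trace.re := by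
      rw [trace_mul_comm]
      conv_lhs => rw [← hX.eq, ← conjTranspose_mul, trace_conjTranspose]
      simp
    have h2 : (W * X).trace.re = 1 / 2 * ((Z * X).trace.re + (Zᴴ * X).trace.re) := by
      simp only [W, hermPart_apply, smul_mul_assoc, add_mul, trace_smul, trace_add, Complex.smul_re,
        Complex.add_re, smul_eq_mul]
    rw [h2, h1, hgZ]; ring
  set U := hW.eigenvectorUnitary
  have hUU : (U : Matrix ι ι ℂ)ᴴ * (U : Matrix ι ι ℂ) = 1 := Unitary.coe_star_mul_self U
  have hsum : ∀ X, X.IsHermitian →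
      g X = ∑ i, hW.eigenvalues i * (((U : Matrix ι ι ℂ)ᴴ * X * (U : Matrix ι ι ℂ)) i i).re := by
    intro X hX
    have hsp := hW.spectral_theorem
    rw [Unitary.conjStarAlgAut_apply] at hsp
    rw [hgW X hX]
    refine (congrArg (fun M => (M * X).trace.re) hsp).trans ?_
    have : ((U : Matrix ι ι ℂ) * diagonal (RCLike.ofReal ∘ hW.eigenvalues) * star (U : Matrix ι ι ℂ) * X).trace
      = (diagonal (RCLike.ofReal ∘ hW.eigenvalues) * ((U : Matrix ι ι ℂ)ᴴ * X * (U : Matrix ι ι ℂ))).trace := by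
      rw [mul_assoc, mul_assoc, trace_mul_comm, star_eq_conjTranspose]
      simp only [mul_assoc]
    rw [this]
    simp [trace, diagonal_mul, Complex.re_sum]
  have hconj : ∀ D : Matrix ι ι ℂ,
      (U : Matrix ι ι ℂ)ᴴ * ((U : Matrix ι ι ℂ) * D * (U : Matrix ι ι ℂ)ᴴ) * (U : Matrix ι ι ℂ) = D := by
    intro D
    calc _ = ((U : Matrix ι ι ℂ)ᴴ * (U : Matrix ι ι ℂ)) * D * ((U : Matrix ι ι ℂ)ᴴ * (U : Matrix ι ι ℂ)) := by
          simp only [mul_assoc]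
      _ = D := by rw [hUU]; simp
  -- Testing g on the rank-one projection onto the k-th eigenvector returns the k-th eigenvalue.
  have hnn : ∀ k, 0 ≤ hW.eigenvalues k := by
    intro k
    have hD : (diagonal (Pi.single k (1 : ℂ))).PosSemidef := by
      apply PosSemidef.diagonal
      intro i
      by_cases h : i = k
      · subst h; simp
      · simp [h]
    have h := hD.mul_mul_conjTranspose_same (U : Matrix ι ι ℂ)
    have h' := hg _ h
    rw [hsum _ h.isHermitian, hconj, Finset.sum_eq_single k] at h'
    · simpa using h'
    · intro i _ hi; simp [hi]
    · simp
  have hex : ∃ k, 0 < hW.eigenvalues k := by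
    by_contra hcon
    push Not at hcon
    have : g 1 ≤ 0 := by
      rw [hsum 1 isHermitian_one, mul_one, hUU]
      apply Finset.sum_nonpos
      intro i _
      simpa using hcon i
    linarith
  obtain ⟨k, hk⟩ := hex
  refine ⟨U, k, _, hk, fun X hX => ?_⟩
  have hY := hX.conjTranspose_mul_mul_same (U : Matrix ι ι ℂ)
  rw [hsum X hX.isHermitian]
  exact Finset.single_le_sum (f := fun i => hW.eigenvalues i *
    (((U : Matrix ι ι ℂ)ᴴ * X * (U : Matrix ι ι ℂ)) i i).re)
    (fun i _ => mul_nonneg (hnn i) (diag_re_nonneg hY i)) (Finset.mem_univ k)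

/-- Dropping a coordinate with small diagonal entry from a positive semidefinite matrix. -/
lemma norm_sub_compress_sq_le (U : Matrix.unitaryGroup ι ℂ) (k : ι) {V : Matrix ι {j // j ≠ k} ℂ}
    (hV : V = (U : Matrix ι ι ℂ).submatrix id Subtype.val) {Q : Matrix ι ι ℂ} (hQ : Q.PosSemidef) :
    ‖Q - V * (Vᴴ * Q * V) * Vᴴ‖ ^ 2 ≤ 2 * Fintype.card ι * ‖(U : Matrix ι ι ℂ)‖ ^ 4 * ‖Q‖ *
      (((U : Matrix ι ι ℂ)ᴴ * Q * (U : Matrix ι ι ℂ)) k k).re := by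
  set u : Matrix ι ι ℂ := (U : Matrix ι ι ℂ)
  have huu : u * uᴴ = 1 := Unitary.coe_mul_star_self U
  set W := uᴴ * Q * u
  have hW : W.PosSemidef := hQ.conjTranspose_mul_mul_same u
  set D : Matrix ι ι ℂ := diagonal fun j => if j = k then 0 else 1
  have hVV : V * Vᴴ = u * D * uᴴ := by
    ext i l
    rw [mul_apply, mul_apply, hV]
    simp only [D, mul_diagonal, conjTranspose_apply, submatrix_apply, id_eq]
    rw [← Finset.sum_subtype (p := fun j => j ≠ k) (Finset.univ.filter (· ≠ k)) (by simp)
      (fun j => u i j * star (u l j)), Finset.sum_filter]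
    refine Finset.sum_congr rfl fun j _ => ?_
    by_cases h : j = k <;> simp [h]
  have hdiff : Q - V * (Vᴴ * Q * V) * Vᴴ = u * (W - D * W * D) * uᴴ := by
    have h1 : V * (Vᴴ * Q * V) * Vᴴ = (V * Vᴴ) * Q * (V * Vᴴ) := by
      simp only [Matrix.mul_assoc]
    have h2 : Q = u * uᴴ * Q * (u * uᴴ) := by rw [huu]; simp
    rw [h1, hVV, mul_sub, sub_mul]
    congr 1
    · conv_lhs => rw [h2]
      simp only [W, mul_assoc]
    · simp only [W, mul_assoc]
  -- Only row and column k survive in W - DWD, and the 2×2 minors bound them by the diagonal entry W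
  -- k k.
  have hent : ∀ i j, ‖(W - D * W * D) i j‖ ^ 2
      ≤ (if i = k then ‖W k j‖ ^ 2 else 0) + (if j = k then ‖W i k‖ ^ 2 else 0) := by
    intro i j
    simp only [D, Matrix.sub_apply, mul_diagonal, diagonal_mul]
    by_cases hi : i = k <;> by_cases hj : j = k <;> simp [hi, hj]
  have htr : W.trace.re ≤ Fintype.card ι * ‖Q‖ := by
    have : W.trace = Q.trace := by
      simp only [W]; rw [trace_mul_comm, ← mul_assoc, huu, one_mul]
    rw [this]
    exact (le_abs_self _).trans (abs_trace_re_le Q)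
  have hsum : ‖W - D * W * D‖ ^ 2 ≤ 2 * ((W k k).re * W.trace.re) := by
    rw [norm_sq_eq_sum]
    calc _ ≤ ∑ i, ∑ j, ((if i = k then ‖W k j‖ ^ 2 else 0) + (if j = k then ‖W i k‖ ^ 2 else 0)) :=
          Finset.sum_le_sum fun i _ => Finset.sum_le_sum fun j _ => hent i j
      _ = ∑ j, ‖W k j‖ ^ 2 + ∑ i, ‖W i k‖ ^ 2 := by
          simp only [Finset.sum_add_distrib]
          congr 1
          · rw [Finset.sum_comm]; simp
          · simp
      _ ≤ ∑ j, (W k k).re * (W j j).re + ∑ i, (W i i).re * (W k k).re := by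
          gcongr <;> exact norm_entry_sq_le hW _ _
      _ = _ := by
          rw [← Finset.mul_sum, ← Finset.sum_mul]
          simp only [trace, diag_apply, Complex.re_sum]; ring
  have hk := diag_re_nonneg hW k
  have hn : ‖Q - V * (Vᴴ * Q * V) * Vᴴ‖ ≤ ‖u‖ ^ 2 * ‖W - D * W * D‖ := by
    rw [hdiff]
    calc _ ≤ ‖u * (W - D * W * D)‖ * ‖uᴴ‖ := frobenius_norm_mul _ _
      _ ≤ (‖u‖ * ‖W - D * W * D‖) * ‖uᴴ‖ := by gcongr; exact frobenius_norm_mul _ _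
      _ = _ := by rw [frobenius_norm_conjTranspose]; ring
  calc _ ≤ (‖u‖ ^ 2 * ‖W - D * W * D‖) ^ 2 := by gcongr
    _ = ‖u‖ ^ 4 * ‖W - D * W * D‖ ^ 2 := by ring
    _ ≤ ‖u‖ ^ 4 * (2 * ((W k k).re * (Fintype.card ι * ‖Q‖))) := by
        gcongr; exact hsum.trans (by gcongr)
    _ = _ := by ring

/-- Merges different powers of a bounded residual into the smallest exponent. -/
lemma rpow_le_mul_rpow {x M a b : ℝ} (hx : 0 ≤ x) (hM : 1 ≤ M) (hxM : x ≤ M) (hb : 0 < b)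
    (hba : b ≤ a) (ha : a ≤ 1) : x ^ a ≤ M * x ^ b := by
  rcases hx.eq_or_lt with rfl | hx
  · rw [Real.zero_rpow (by linarith), Real.zero_rpow hb.ne', mul_zero]
  · have : x ^ a = x ^ (a - b) * x ^ b := by rw [← Real.rpow_add hx]; congr 1; ring
    rw [this]
    gcongr
    calc x ^ (a - b) ≤ M ^ (a - b) := Real.rpow_le_rpow hx.le hxM (by linarith)
      _ ≤ M ^ (1 : ℝ) := Real.rpow_le_rpow_of_exponent_le hM (by linarith)
      _ = M := Real.rpow_one M

/-- Hölder error bound for spectrahedra (Sturm): on bounded sets, the distance of a positive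
semidefinite matrix to the solution set of a consistent linear system is bounded by a power of the
residual. -/
theorem exists_holder_error_bound {F : Type*} [NormedAddCommGroup F] [NormedSpace ℝ F] (d : ℕ) :
    ∀ (ι : Type*) [Fintype ι] [DecidableEq ι], Fintype.card ι = d →
      ∀ (A : Matrix ι ι ℂ →ₗ[ℝ] F) (P : Matrix ι ι ℂ), P.PosSemidef → ∀ R : ℝ,
      ∃ C γ : ℝ, 0 ≤ C ∧ 0 < γ ∧ γ ≤ 1 ∧ ∀ Q : Matrix ι ι ℂ, Q.PosSemidef → ‖Q‖ ≤ R →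
        ∃ Q' : Matrix ι ι ℂ, Q'.PosSemidef ∧ A Q' = A P ∧ ‖Q - Q'‖ ≤ C * ‖A Q - A P‖ ^ γ := by
  induction d using Nat.strong_induction_on with
  | _ d ih =>
  intro ι _ _ hcard A P hP R
  -- With a positive definite solution the bound is Lipschitz, γ = 1. Otherwise an exposing
  -- functional makes one diagonal entry, in a suitable basis, of the order of the residual.
  -- Dropping that coordinate costs the square root of the residual, so every reduction halves the
  -- exponent.
  by_cases hpd : ∃ X : Matrix ι ι ℂ, X.PosDef ∧ A X = A P
  · obtain ⟨X, hX, hAX⟩ := hpd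
    obtain ⟨C, hC⟩ := exists_near_of_posDef A hX R
    refine ⟨|C|, 1, abs_nonneg C, one_pos, le_rfl, fun Q hQ hQR => ?_⟩
    obtain ⟨Q', h1, h2, h3⟩ := hC Q hQ hQR
    refine ⟨Q', h1, h2.trans hAX, ?_⟩
    rw [Real.rpow_one, ← hAX]
    exact h3.trans (by gcongr; exact le_abs_self C)
  push Not at hpd
  obtain ⟨g, hg, hg1, c, hc, hgc⟩ := exists_exposing_functional A hP hpd
  obtain ⟨U, k, e, he, hUk⟩ := exists_unitary_diag_le hg hg1
  obtain ⟨V, hV⟩ : ∃ V : Matrix ι {j // j ≠ k} ℂ, V = (U : Matrix ι ι ℂ).submatrix id Subtype.val :=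
    ⟨_, rfl⟩
  let emb : Matrix {j // j ≠ k} {j // j ≠ k} ℂ →ₗ[ℝ] Matrix ι ι ℂ :=
    { toFun := fun Y => V * Y * Vᴴ
      map_add' := fun X Y => by rw [Matrix.mul_add, Matrix.add_mul]
      map_smul' := fun r X => by simp }
  have hemb : ∀ Y, emb Y = V * Y * Vᴴ := fun Y => rfl
  obtain ⟨a, ha, hA⟩ := A.exists_pos_bound
  set N := Fintype.card ι
  set w := ‖(U : Matrix ι ι ℂ)‖
  have hcomp : ∀ Q : Matrix ι ι ℂ, Q.PosSemidef →
      ‖Q - emb (Vᴴ * Q * V)‖ ^ 2 ≤ 2 * N * w ^ 4 * ‖Q‖ * (c / e) * ‖A Q - A P‖ := by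
    intro Q hQ
    have h1 := norm_sub_compress_sq_le U k hV hQ
    have h2 := (hUk Q hQ).trans ((le_abs_self _).trans (hgc Q hQ.isHermitian))
    have h3 : (((U : Matrix ι ι ℂ)ᴴ * Q * (U : Matrix ι ι ℂ)) k k).re ≤ c / e * ‖A Q - A P‖ := by
      rw [div_mul_eq_mul_div, le_div_iff₀ he]; linarith
    rw [hemb]
    calc _ ≤ _ := h1
      _ ≤ 2 * N * w ^ 4 * ‖Q‖ * (c / e * ‖A Q - A P‖) := by gcongr
      _ = _ := by ring
  -- `P` has residual zero, so it lies exactly on the smaller face and the reduced system is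
  -- consistent.
  have hPe : emb (Vᴴ * P * V) = P := by
    have h := hcomp P hP
    rw [sub_self, norm_zero, mul_zero] at h
    have h' : ‖P - emb (Vᴴ * P * V)‖ = 0 := by
      apply pow_eq_zero_iff (two_ne_zero) |>.1
      exact le_antisymm h (sq_nonneg _)
    exact (sub_eq_zero.1 (norm_eq_zero.1 h')).symm
  have hlt : Fintype.card {j // j ≠ k} < d := by
    rw [← hcard]; exact Fintype.card_subtype_lt (x := k) (by simp)
  obtain ⟨C, γ, hC, hγ, hγ1, hrec⟩ := ih _ hlt {j // j ≠ k} rfl (A ∘ₗ emb) (Vᴴ * P * V)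
    (hP.conjTranspose_mul_mul_same V) (‖Vᴴ‖ * R * ‖V‖)
  have hAP : (A ∘ₗ emb) (Vᴴ * P * V) = A P := by rw [LinearMap.comp_apply, hPe]
  rw [hAP] at hrec
  -- `R` may be negative, in which case there is no Q to treat; R' keeps the constants nonnegative.
  set R' := max R 0
  set M := max 1 (a * (R' + ‖P‖))
  set s := √(2 * N * w ^ 4 * R' * (c / e)) with hs
  have hs0 : 0 ≤ s := Real.sqrt_nonneg _
  have hM1 : 1 ≤ M := le_max_left _ _
  have hR'0 : 0 ≤ R' := le_max_right _ _
  -- The first term is the distance to the face. The second is the inductive bound on the face,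
  -- where the residual has grown to at most (M + a s) r^(1/2).
  refine ⟨s * M + ‖V‖ ^ 2 * C * (M + a * s) ^ γ, γ / 2, by positivity, by linarith, by linarith,
    fun Q hQ hQR => ?_⟩
  have hQR' : ‖Q‖ ≤ R' := hQR.trans (le_max_left _ _)
  set r := ‖A Q - A P‖ with hr
  have hr0 : 0 ≤ r := norm_nonneg _
  have hrM : r ≤ M := by
    rw [hr, ← map_sub]
    calc _ ≤ a * ‖Q - P‖ := hA _
      _ ≤ a * (R' + ‖P‖) := by gcongr; exact (norm_sub_le _ _).trans (by gcongr)
      _ ≤ M := le_max_right _ _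
  have hd : ‖Q - emb (Vᴴ * Q * V)‖ ≤ s * r ^ (1 / 2 : ℝ) := by
    rw [← Real.sqrt_eq_rpow, hs, ← Real.sqrt_mul (by positivity)]
    apply Real.le_sqrt_of_sq_le
    refine (hcomp Q hQ).trans ?_
    gcongr
  have hYR : ‖Vᴴ * Q * V‖ ≤ ‖Vᴴ‖ * R * ‖V‖ := by
    calc _ ≤ ‖Vᴴ * Q‖ * ‖V‖ := frobenius_norm_mul _ _
      _ ≤ (‖Vᴴ‖ * ‖Q‖) * ‖V‖ := by gcongr; exact frobenius_norm_mul _ _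
      _ ≤ _ := by gcongr
  obtain ⟨Y, hY, hAY, hYn⟩ := hrec (Vᴴ * Q * V) (hQ.conjTranspose_mul_mul_same V) hYR
  have hres : ‖(A ∘ₗ emb) (Vᴴ * Q * V) - A P‖ ≤ (M + a * s) * r ^ (1 / 2 : ℝ) := by
    have h1 : (A ∘ₗ emb) (Vᴴ * Q * V) - A P = (A Q - A P) - A (Q - emb (Vᴴ * Q * V)) := by
      rw [map_sub, LinearMap.comp_apply]; abel
    rw [h1]
    calc _ ≤ r + a * ‖Q - emb (Vᴴ * Q * V)‖ := (norm_sub_le _ _).trans (by gcongr; exact hA _)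
      _ ≤ M * r ^ (1 / 2 : ℝ) + a * (s * r ^ (1 / 2 : ℝ)) := by
          gcongr
          simpa using rpow_le_mul_rpow hr0 hM1 hrM (b := 1 / 2) (a := 1) (by norm_num)
            (by norm_num) le_rfl
      _ = _ := by ring
  refine ⟨emb Y, hY.mul_mul_conjTranspose_same V, hAY, ?_⟩
  have hembn : ‖emb (Vᴴ * Q * V) - emb Y‖ ≤ ‖V‖ ^ 2 * ‖Vᴴ * Q * V - Y‖ := by
    rw [← map_sub, hemb]
    calc _ ≤ ‖V * (Vᴴ * Q * V - Y)‖ * ‖Vᴴ‖ := frobenius_norm_mul _ _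
      _ ≤ (‖V‖ * ‖Vᴴ * Q * V - Y‖) * ‖Vᴴ‖ := by gcongr; exact frobenius_norm_mul _ _
      _ = _ := by rw [frobenius_norm_conjTranspose]; ring
  calc ‖Q - emb Y‖ ≤ ‖Q - emb (Vᴴ * Q * V)‖ + ‖emb (Vᴴ * Q * V) - emb Y‖ := norm_sub_le_norm_sub_add_norm_sub _ _ _
    _ ≤ s * r ^ (1 / 2 : ℝ) + ‖V‖ ^ 2 * (C * ((M + a * s) * r ^ (1 / 2 : ℝ)) ^ γ) := by
        gcongr
        refine hembn.trans ?_
        gcongr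
        exact hYn.trans (by gcongr)
    _ ≤ s * (M * r ^ (γ / 2)) + ‖V‖ ^ 2 * (C * ((M + a * s) ^ γ * r ^ (γ / 2))) := by
        gcongr
        · exact rpow_le_mul_rpow hr0 hM1 hrM (by linarith) (by linarith) (by norm_num)
        · rw [Real.mul_rpow (by positivity) (by positivity), ← Real.rpow_mul hr0]
          apply le_of_eq; congr 2; ring
    _ = _ := by ring

end ErrorBound

/-! ### The sum rate and block optimality -/

section Mac

open scoped Matrix.Norms.Frobenius

variable {K m n : ℕ}

/-- The received covariance `I + ∑ i, H i (Q i) (H i)†`. -/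
noncomputable def totalCov (H : Fin K → Matrix (Fin m) (Fin n) ℂ) (Q : Fin K → Matrix (Fin n) (Fin n) ℂ) :
    Matrix (Fin m) (Fin m) ℂ :=
  1 + ∑ i, H i * Q i * (H i)ᴴ

lemma sumRate_eq_logDet (H : Fin K → Matrix (Fin m) (Fin n) ℂ)
    (Q : Fin K → Matrix (Fin n) (Fin n) ℂ) : sumRate H Q = logDet (totalCov H Q) := rfl

lemma posSemidef_finset_sum {ι κ : Type*} (s : Finset κ) {f : κ → Matrix ι ι ℂ}
    (hf : ∀ k ∈ s, (f k).PosSemidef) : (∑ k ∈ s, f k).PosSemidef :=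
  posSemidef_sum s hf

lemma posDef_totalCov (H : Fin K → Matrix (Fin m) (Fin n) ℂ) {Q : Fin K → Matrix (Fin n) (Fin n) ℂ}
    (hQ : ∀ i, (Q i).PosSemidef) : (totalCov H Q).PosDef :=
  PosDef.one.add_posSemidef
    (posSemidef_finset_sum _ fun i _ => (hQ i).mul_mul_conjTranspose_same (H i))

lemma posDef_interference (H : Fin K → Matrix (Fin m) (Fin n) ℂ)
    {Q : Fin K → Matrix (Fin n) (Fin n) ℂ} (hQ : ∀ i, (Q i).PosSemidef) (i : Fin K) :
    (interference H Q i).PosDef :=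
  PosDef.one.add_posSemidef
    (posSemidef_finset_sum _ fun i _ => (hQ i).mul_mul_conjTranspose_same (H i))

lemma interference_add (H : Fin K → Matrix (Fin m) (Fin n) ℂ)
    (Q : Fin K → Matrix (Fin n) (Fin n) ℂ) (i : Fin K) (R : Matrix (Fin n) (Fin n) ℂ) :
    interference H Q i + H i * R * (H i)ᴴ = totalCov H (Function.update Q i R) := by
  rw [interference, totalCov, ← Finset.sum_erase_add _ _ (Finset.mem_univ i), Function.update_self,
    add_assoc]
  congr 2
  refine Finset.sum_congr rfl fun k hk => ?_
  rw [Function.update_of_ne (Finset.ne_of_mem_erase hk)]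

lemma totalCov_update_sub (H : Fin K → Matrix (Fin m) (Fin n) ℂ)
    (Q : Fin K → Matrix (Fin n) (Fin n) ℂ) (i : Fin K) (R : Matrix (Fin n) (Fin n) ℂ) :
    totalCov H (Function.update Q i R) = totalCov H Q + H i * (R - Q i) * (H i)ᴴ := by
  have h := interference_add H Q i (Q i)
  rw [Function.update_eq_self] at h
  rw [← interference_add, ← h, Matrix.mul_sub, Matrix.sub_mul]
  abel

lemma posSemidef_update {Q : Fin K → Matrix (Fin n) (Fin n) ℂ} (hQ : ∀ i, (Q i).PosSemidef)
    (i : Fin K) {R : Matrix (Fin n) (Fin n) ℂ} (hR : R.PosSemidef) (k : Fin K) :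
    (Function.update Q i R k).PosSemidef := by
  by_cases h : k = i
  · subst h; simpa using hR
  · simpa [Function.update_of_ne h] using hQ k

/-- The rate over the effective channel is the sum rate up to a constant. -/
lemma rate_effectiveChannel (H : Fin K → Matrix (Fin m) (Fin n) ℂ)
    {Q : Fin K → Matrix (Fin n) (Fin n) ℂ} (hQ : ∀ i, (Q i).PosSemidef) (i : Fin K)
    {R : Matrix (Fin n) (Fin n) ℂ} (hR : R.PosSemidef) :
    rate (effectiveChannel H Q i) R
      = sumRate H (Function.update Q i R) - logDet (interference H Q i) := by
  have hW := posDef_interference H hQ i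
  have hL := isHermitian_invSqrt (interference H Q i)
  have hS := posDef_totalCov H (posSemidef_update hQ i hR)
  rw [sumRate_eq_logDet, ← logDet_conj hW hS (invSqrt_mul_mul_invSqrt hW), ← interference_add]
  rw [rate, logDet, mul_add, add_mul, invSqrt_mul_mul_invSqrt hW, effectiveChannel,
    conjTranspose_mul, hL.eq]
  simp only [Matrix.mul_assoc]

/-- No feasible change of the covariance of user `i` alone increases the sum rate. -/
def IsBlockOptimal (H : Fin K → Matrix (Fin m) (Fin n) ℂ) (P : Fin K → Fin n → ℝ) (i : Fin K)
    (Q : Fin K → Matrix (Fin n) (Fin n) ℂ) : Prop :=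
  ∀ R, IsAdmissible (P i) R → sumRate H (Function.update Q i R) ≤ sumRate H Q

section UserUpdate

variable {H : Fin K → Matrix (Fin m) (Fin n) ℂ} {P : Fin K → Fin n → ℝ} {i : Fin K}
  {Q Q' : Fin K → Matrix (Fin n) (Fin n) ℂ}

lemma update_mem_feasibleSet (hQ : Q ∈ feasibleSet P) {R : Matrix (Fin n) (Fin n) ℂ}
    (hR : IsAdmissible (P i) R) : Function.update Q i R ∈ feasibleSet P := by
  intro k
  by_cases h : k = i
  · subst h; simpa using hR
  · simpa [Function.update_of_ne h] using hQ k

lemma IsUserUpdate.eq_update (h : IsUserUpdate H P i Q Q') : Q' = Function.update Q i (Q' i) := by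
  ext1 k
  by_cases hk : k = i
  · subst hk; simp
  · rw [Function.update_of_ne hk, h.1 k hk]

lemma IsUserUpdate.mem_feasibleSet (h : IsUserUpdate H P i Q Q') (hQ : Q ∈ feasibleSet P) :
    Q' ∈ feasibleSet P := by
  rw [h.eq_update]
  exact update_mem_feasibleSet hQ h.2.1

/-- The constant separating the two rates is the log det of the interference, in which the
covariance of user i does not occur. -/
lemma IsUserUpdate.isBlockOptimal (h : IsUserUpdate H P i Q Q') (hQ : Q ∈ feasibleSet P) :
    IsBlockOptimal H P i Q' := by
  intro R hR
  have hps : ∀ k, (Q k).PosSemidef := fun k => (hQ k).1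
  have h1 := h.2.2 R hR
  rw [rate_effectiveChannel H hps i hR.1, rate_effectiveChannel H hps i h.2.1.1, ← h.eq_update] at h1
  have h2 : Function.update Q' i R = Function.update Q i R := by
    rw [h.eq_update, Function.update_idem]
  rw [h2]
  linarith

end UserUpdate

lemma IsAdmissible.convex_comb {p : Fin n → ℝ} {Q R : Matrix (Fin n) (Fin n) ℂ}
    (hQ : IsAdmissible p Q) (hR : IsAdmissible p R) {a b : ℝ} (ha : 0 ≤ a) (hb : 0 ≤ b)
    (hab : a + b = 1) : IsAdmissible p (a • Q + b • R) := by
  refine ⟨(posSemidef_real_smul hQ.1 ha).add (posSemidef_real_smul hR.1 hb), fun j => ?_⟩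
  have h1 := mul_le_mul_of_nonneg_left (hQ.2 j) ha
  have h2 := mul_le_mul_of_nonneg_left (hR.2 j) hb
  simp only [Matrix.add_apply, Matrix.smul_apply, Complex.add_re, Complex.smul_re, smul_eq_mul]
  calc _ ≤ a * p j + b * p j := add_le_add h1 h2
    _ = p j := by rw [← add_mul, hab, one_mul]

/-- The tangent inequality of a concave function: the quadratic term is dropped. -/
lemma logDet_le {A B : Matrix (Fin m) (Fin m) ℂ} (hA : A.PosDef) (hB : B.PosDef) :
    logDet B ≤ logDet A + (A⁻¹ * (B - A)).trace.re := by
  have h := logDet_le_of_bounded hA hB (b := ‖A‖ + ‖A⁻¹‖ + ‖B‖)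
    (by linarith [norm_nonneg A⁻¹, norm_nonneg B]) (by linarith [norm_nonneg A, norm_nonneg B])
    (by linarith [norm_nonneg A⁻¹, norm_nonneg A])
  refine h.trans (sub_le_self _ (by positivity))

lemma continuousAt_inv_of_posDef {A : Matrix (Fin m) (Fin m) ℂ} (hA : A.PosDef) :
    ContinuousAt (fun B : Matrix (Fin m) (Fin m) ℂ => B⁻¹) A := by
  have : (fun B : Matrix (Fin m) (Fin m) ℂ => B⁻¹) = Ring.inverse := by
    ext1 B; exact nonsing_inv_eq_ringInverse B
  rw [this]
  obtain ⟨u, rfl⟩ := hA.isUnit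
  exact NormedRing.inverse_continuousAt u

/-- First-order optimality for `log det` along a segment. -/
lemma trace_inv_mul_le_zero {A D : Matrix (Fin m) (Fin m) ℂ} (hA : A.PosDef)
    (h : ∀ ε : ℝ, 0 < ε → ε ≤ 1 → (A + ε • D).PosDef ∧ logDet (A + ε • D) ≤ logDet A) :
    (A⁻¹ * D).trace.re ≤ 0 := by
  have hcont : Tendsto (fun ε : ℝ => ((A + ε • D)⁻¹ * D).trace.re) (𝓝[>] 0) (𝓝 (A⁻¹ * D).trace.re) := by
    have h1 : ContinuousAt (fun ε : ℝ => ((A + ε • D)⁻¹ * D).trace.re) 0 := by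
      have h2 : ContinuousAt (fun ε : ℝ => (A + ε • D)⁻¹) 0 := by
        apply ContinuousAt.comp (g := fun B : Matrix (Fin m) (Fin m) ℂ => B⁻¹)
        · simpa using continuousAt_inv_of_posDef hA
        · fun_prop
      have h3 : Continuous fun B : Matrix (Fin m) (Fin m) ℂ => (B * D).trace.re := by fun_prop
      exact h3.continuousAt.comp h2
    have := h1.tendsto.mono_left (nhdsWithin_le_nhds (s := Set.Ioi 0))
    simpa using this
  refine le_of_tendsto hcont ?_
  filter_upwards [Ioc_mem_nhdsGT (zero_lt_one' ℝ)] with ε hε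
  obtain ⟨h1, h2⟩ := h ε hε.1 hε.2
  -- The tangent is taken at A + εD and evaluated at A. This gives the sign of the slope at A + εD,
  -- and ε → 0 finishes without differentiating log det.
  have h3 := logDet_le h1 hA
  have e : A - (A + ε • D) = (-ε) • D := by rw [neg_smul]; abel
  rw [e, mul_smul_comm, trace_smul, Complex.smul_re, smul_eq_mul] at h3
  have : 0 ≤ -ε * ((A + ε • D)⁻¹ * D).trace.re := by linarith
  nlinarith [hε.1]

section

variable {H : Fin K → Matrix (Fin m) (Fin n) ℂ} {P : Fin K → Fin n → ℝ} {i : Fin K}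
  {Q : Fin K → Matrix (Fin n) (Fin n) ℂ}

/-- First-order optimality of a block-optimal tuple. -/
lemma IsBlockOptimal.trace_le_zero (h : IsBlockOptimal H P i Q) (hQ : Q ∈ feasibleSet P)
    {R : Matrix (Fin n) (Fin n) ℂ} (hR : IsAdmissible (P i) R) :
    ((totalCov H Q)⁻¹ * (H i * (R - Q i) * (H i)ᴴ)).trace.re ≤ 0 := by
  apply trace_inv_mul_le_zero (posDef_totalCov H fun k => (hQ k).1)
  intro ε h0 h1
  have hadm : IsAdmissible (P i) ((1 - ε) • Q i + ε • R) :=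
    (hQ i).convex_comb hR (by linarith) h0.le (by ring)
  have e : totalCov H Q + ε • (H i * (R - Q i) * (H i)ᴴ)
      = totalCov H (Function.update Q i ((1 - ε) • Q i + ε • R)) := by
    rw [totalCov_update_sub]
    congr 1
    rw [← Matrix.smul_mul, ← Matrix.mul_smul]
    congr 2
    module
  rw [e]
  exact ⟨posDef_totalCov H fun k => (update_mem_feasibleSet hQ hadm k).1, h _ hadm⟩

end

/-! ### Compactness, existence of optimal tuples and uniform bounds -/

lemma isClosed_posSemidef (ι : Type*) [Fintype ι] : IsClosed {Q : Matrix ι ι ℂ | Q.PosSemidef} := by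
  have : {Q : Matrix ι ι ℂ | Q.PosSemidef}
      = {Q | Qᴴ = Q} ∩ ⋂ x : ι → ℂ, {Q | 0 ≤ star x ⬝ᵥ (Q *ᵥ x)} := by
    ext Q
    simp only [Set.mem_ofPred_eq, posSemidef_iff_dotProduct_mulVec, Set.mem_inter_iff, Set.mem_iInter]
    rfl
  rw [this]
  refine (isClosed_eq (by fun_prop) (by fun_prop)).inter (isClosed_iInter fun x => ?_)
  exact isClosed_le (by fun_prop) (by fun_prop)

/-- The trace of a positive semidefinite matrix bounds its norm, so the diagonal budgets also
control the off-diagonal entries. -/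
lemma isCompact_feasibleSet (P : Fin K → Fin n → ℝ) : IsCompact (feasibleSet P) := by
  have hcl : IsClosed (feasibleSet P) := by
    have : feasibleSet P = ⋂ i, ((fun Q : Fin K → Matrix (Fin n) (Fin n) ℂ => Q i) ⁻¹'
        ({Q | Q.PosSemidef} ∩ ⋂ j, {Q | (Q j j).re ≤ P i j})) := by
      ext Q; simp [feasibleSet, IsAdmissible]
    rw [this]
    refine isClosed_iInter fun i => IsClosed.preimage (by fun_prop) ?_
    refine (isClosed_posSemidef _).inter (isClosed_iInter fun j => isClosed_le (by fun_prop) (by fun_prop))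
  refine Metric.isCompact_of_isClosed_isBounded hcl ?_
  rw [isBounded_iff_forall_norm_le]
  refine ⟨∑ i, |∑ j, P i j|, fun Q hQ => ?_⟩
  rw [pi_norm_le_iff_of_nonneg (by positivity)]
  intro i
  refine (norm_le_trace (hQ i).1).trans ?_
  calc (Q i).trace.re ≤ ∑ j, P i j := by
        simp only [trace, diag_apply, Complex.re_sum]
        exact Finset.sum_le_sum fun j _ => (hQ i).2 j
    _ ≤ |∑ j, P i j| := le_abs_self _
    _ ≤ _ := Finset.single_le_sum (f := fun i => |∑ j, P i j|) (fun _ _ => abs_nonneg _) (Finset.mem_univ i)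

lemma continuous_totalCov (H : Fin K → Matrix (Fin m) (Fin n) ℂ) : Continuous (totalCov H) := by
  unfold totalCov; fun_prop

lemma continuousOn_sumRate (H : Fin K → Matrix (Fin m) (Fin n) ℂ) (P : Fin K → Fin n → ℝ) :
    ContinuousOn (sumRate H) (feasibleSet P) := by
  have h1 : Continuous fun Q => (totalCov H Q).det.re :=
    Complex.continuous_re.comp (continuous_totalCov H).matrix_det
  exact h1.continuousOn.log fun Q hQ => (det_re_pos (posDef_totalCov H fun i => (hQ i).1)).ne'

lemma exists_isSumRateOptimal (H : Fin K → Matrix (Fin m) (Fin n) ℂ) {P : Fin K → Fin n → ℝ}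
    (h : (feasibleSet P).Nonempty) : ∃ Q, IsSumRateOptimal H P Q := by
  obtain ⟨Q, hQ, hmax⟩ := (isCompact_feasibleSet P).exists_isMaxOn h (continuousOn_sumRate H P)
  exact ⟨Q, hQ, fun R hR => hmax hR⟩

lemma IsSumRateOptimal.isBlockOptimal {H : Fin K → Matrix (Fin m) (Fin n) ℂ} {P : Fin K → Fin n → ℝ}
    {Q : Fin K → Matrix (Fin n) (Fin n) ℂ} (h : IsSumRateOptimal H P Q) (i : Fin K) :
    IsBlockOptimal H P i Q :=
  fun _ hR => h.2 _ (update_mem_feasibleSet h.1 hR)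

lemma exists_bound_totalCov (H : Fin K → Matrix (Fin m) (Fin n) ℂ) (P : Fin K → Fin n → ℝ) :
    ∃ b : ℝ, 0 ≤ b ∧ ∀ Q ∈ feasibleSet P, ‖Q‖ ≤ b ∧ ‖totalCov H Q‖ ≤ b ∧ ‖(totalCov H Q)⁻¹‖ ≤ b := by
  have hc := isCompact_feasibleSet P
  obtain ⟨b1, h1⟩ := hc.exists_bound_of_continuousOn (f := fun Q => Q) continuousOn_id
  obtain ⟨b2, h2⟩ := hc.exists_bound_of_continuousOn (continuous_totalCov H).continuousOn
  have hinv : ContinuousOn (fun Q => (totalCov H Q)⁻¹) (feasibleSet P) := fun Q hQ =>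
    (ContinuousAt.comp (f := totalCov H)
      (continuousAt_inv_of_posDef (posDef_totalCov H fun i => (hQ i).1))
      (continuous_totalCov H).continuousAt).continuousWithinAt
  obtain ⟨b3, h3⟩ := hc.exists_bound_of_continuousOn hinv
  refine ⟨max 0 (max b1 (max b2 b3)), le_max_left _ _, fun Q hQ => ⟨?_, ?_, ?_⟩⟩
  · exact (h1 Q hQ).trans (by simp)
  · exact (h2 Q hQ).trans (by simp)
  · exact (h3 Q hQ).trans (by simp)

/-- Strong concavity of the sum rate in the received covariance on the feasible set. -/
lemma exists_strong_concavity (H : Fin K → Matrix (Fin m) (Fin n) ℂ) (P : Fin K → Fin n → ℝ) :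
    ∃ κ : ℝ, 0 < κ ∧ ∀ Q ∈ feasibleSet P, ∀ R ∈ feasibleSet P,
      sumRate H R ≤ sumRate H Q + ((totalCov H Q)⁻¹ * (totalCov H R - totalCov H Q)).trace.re
        - κ * ‖totalCov H R - totalCov H Q‖ ^ 2 := by
  obtain ⟨b, hb, hbd⟩ := exists_bound_totalCov H P
  refine ⟨(2 * (m * b ^ 2 + 1) * ((m * b) ^ 2 + 1))⁻¹, by positivity, fun Q hQ R hR => ?_⟩
  have := logDet_le_of_bounded (posDef_totalCov H fun i => (hQ i).1)
    (posDef_totalCov H fun i => (hR i).1) (hbd Q hQ).2.1 (hbd Q hQ).2.2 (hbd R hR).2.1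
  rw [div_eq_inv_mul] at this
  exact this

end Mac

/-! ### Structure of the set of optimal tuples -/

section OptimalSet

open scoped Matrix.Norms.Frobenius

variable {K m n : ℕ}

/-- A point of the sphere at which a convex quadratic is maximal over the ball is a positive
multiple of the gradient. -/
lemma exists_pos_smul_of_ball_max {E : Type*} [NormedAddCommGroup E] [InnerProductSpace ℂ E]
    {x g : E} {p c : ℝ} (hp : 0 < p) (hx : ‖x‖ ^ 2 = p) (hc : 0 < c)
    (h : ∀ v : E, ‖v‖ ^ 2 ≤ p → 2 * (inner ℂ (v - x) g).re + c * ‖v - x‖ ^ 2 ≤ 0) :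
    ∃ D : ℝ, 0 < D ∧ g = (D : ℂ) • x := by
  have hxpos : 0 < ‖x‖ := by
    rcases (norm_nonneg x).eq_or_lt with h0 | h0
    · rw [← h0] at hx; norm_num at hx; linarith
    · exact h0
  -- A zero gradient is refuted by the antipode -x.
  have hg : g ≠ 0 := by
    rintro rfl
    have h1 := h (-x) (by rw [norm_neg, hx])
    have e : -x - x = (-2 : ℂ) • x := by module
    rw [inner_zero_right, e, norm_smul] at h1
    norm_num at h1
    have : 0 < c * (2 * ‖x‖) ^ 2 := by positivity
    linarith
  have hgpos : 0 < ‖g‖ := norm_pos_iff.2 hg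
  -- The point of the sphere in the direction of g: its linear term is nonnegative by
  -- Cauchy–Schwarz, so the quadratic term forces v = x.
  set v : E := ((‖x‖ / ‖g‖ : ℝ) : ℂ) • g with hv
  have hvn : ‖v‖ = ‖x‖ := by
    rw [hv, norm_smul, Complex.norm_real, Real.norm_of_nonneg (by positivity)]
    field_simp
  have h1 := h v (by rw [hvn, hx])
  have h2 : (inner ℂ v g).re = ‖x‖ * ‖g‖ := by
    rw [hv, inner_smul_left, Complex.conj_ofReal, inner_self_eq_norm_sq_to_K]
    have : ((‖x‖ / ‖g‖ : ℝ) : ℂ) * ((‖g‖ : ℝ) : ℂ) ^ 2 = ((‖x‖ * ‖g‖ : ℝ) : ℂ) := by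
      rw [← Complex.ofReal_pow, ← Complex.ofReal_mul]
      congr 1; field_simp
    exact (congrArg Complex.re this).trans (Complex.ofReal_re _)
  have h3 : (inner ℂ x g).re ≤ ‖x‖ * ‖g‖ :=
    (Complex.re_le_norm _).trans (norm_inner_le_norm x g)
  rw [inner_sub_left, Complex.sub_re, h2] at h1
  have h4 : c * ‖v - x‖ ^ 2 ≤ 0 := by linarith
  have h5 : ‖v - x‖ = 0 := by
    by_contra hne
    have : 0 < ‖v - x‖ := lt_of_le_of_ne (norm_nonneg _) (Ne.symm hne)
    have : 0 < c * ‖v - x‖ ^ 2 := by positivity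
    linarith
  have h6 : v = x := sub_eq_zero.1 (norm_eq_zero.1 h5)
  refine ⟨‖g‖ / ‖x‖, by positivity, ?_⟩
  have : (‖x‖ : ℂ) ≠ 0 := by exact_mod_cast hxpos.ne'
  have : (‖g‖ : ℂ) ≠ 0 := by exact_mod_cast hgpos.ne'
  nth_rewrite 2 [← h6]
  rw [hv, smul_smul]
  push_cast
  rw [div_mul_div_cancel₀ (by assumption), div_self (by assumption), one_smul]

/-- Row-wise stationarity of a maximizer of a linear functional under diagonal constraints. -/
lemma exists_row_multiplier {ι κ : Type*} [Fintype ι] [DecidableEq ι] [Fintype κ]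
    {G : Matrix ι ι ℂ} (hG : G.IsHermitian) {V : Matrix ι κ ℂ} {p : ι → ℝ}
    (hdiag : ∀ j, ((V * Vᴴ) j j).re = p j)
    (hmax : ∀ R : Matrix ι ι ℂ, R.PosSemidef → (∀ j, (R j j).re ≤ p j) →
      (G * R).trace.re ≤ (G * (V * Vᴴ)).trace.re)
    {j : ι} (hp : 0 < p j) (hGj : 0 < (G j j).re) :
    ∃ D : ℝ, 0 < D ∧ ∀ a, (G * V) j a = D * V j a := by
  have hrow : ∀ x : κ → ℂ, ‖WithLp.toLp 2 x‖ ^ 2 = (∑ a, x a * star (x a)).re := by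
    intro x
    rw [EuclideanSpace.norm_sq_eq, Complex.re_sum]
    refine Finset.sum_congr rfl fun a _ => ?_
    rw [RCLike.star_def, Complex.mul_conj, Complex.ofReal_re, Complex.normSq_eq_norm_sq]
  -- Only row j of the factor V is varied. The diagonal constraint then says that the row stays in a
  -- ball, and the objective changes by 2 Re⟨d, (GV)_j⟩ + G_jj‖d‖².
  obtain ⟨D, hD, h⟩ := exists_pos_smul_of_ball_max (x := WithLp.toLp 2 (V j))
    (g := WithLp.toLp 2 ((G * V) j)) hp
    (by rw [hrow, ← hdiag j]; rfl) hGj (by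
      intro v hv
      set d : κ → ℂ := fun a => v a - V j a with hd
      have hvd : v - WithLp.toLp 2 (V j) = WithLp.toLp 2 d := by ext a; simp [hd]
      set E : Matrix ι κ ℂ := Matrix.of fun i a => if i = j then d a else 0 with hE
      have hVE : ∀ i a, (V + E) i a = if i = j then v a else V i a := by
        intro i a
        by_cases hi : i = j
        · subst hi; simp [hE, hd]
        · simp [hE, hi]
      have h1 := hmax ((V + E) * (V + E)ᴴ) (posSemidef_self_mul_conjTranspose _) (by
        intro i
        rw [mul_apply]
        simp only [conjTranspose_apply, hVE]
        by_cases hi : i = j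
        · subst hi
          simp only [if_true]
          rw [← hrow]; exact hv
        · simp only [hi, if_false]
          rw [← hdiag i]; exact le_rfl)
      have e : G * ((V + E) * (V + E)ᴴ) = G * (V * Vᴴ) + (G * E * Vᴴ + G * V * Eᴴ) + G * E * Eᴴ := by
        rw [conjTranspose_add, Matrix.add_mul, Matrix.mul_add, Matrix.mul_add]
        simp only [Matrix.mul_add, Matrix.mul_assoc]
        abel
      have e1 : (G * V * Eᴴ).trace.re = (inner ℂ (v - WithLp.toLp 2 (V j)) (WithLp.toLp 2 ((G * V) j))).re := by
        rw [hvd, EuclideanSpace.inner_toLp_toLp]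
        congr 1
        rw [trace, Finset.sum_eq_single j]
        · rw [diag_apply, mul_apply]
          refine Finset.sum_congr rfl fun a _ => ?_
          simp [hE]
        · intro i _ hi
          rw [diag_apply, mul_apply]
          exact Finset.sum_eq_zero fun a _ => by simp [hE, hi]
        · simp
      have e2 : (G * E * Vᴴ).trace.re = (G * V * Eᴴ).trace.re := by
        have : (G * V * Eᴴ)ᴴ = E * Vᴴ * G := by
          rw [conjTranspose_mul, conjTranspose_mul, conjTranspose_conjTranspose, hG.eq, Matrix.mul_assoc]
        have h2 : (G * E * Vᴴ).trace = star (G * V * Eᴴ).trace := by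
          rw [← trace_conjTranspose, this, Matrix.mul_assoc, trace_mul_comm]
        rw [h2]; simp
      have e3 : (G * E * Eᴴ).trace.re = (G j j).re * ‖v - WithLp.toLp 2 (V j)‖ ^ 2 := by
        have hGE : ∀ i a, (G * E) i a = G i j * d a := by
          intro i a
          rw [mul_apply, Finset.sum_eq_single j]
          · simp [hE]
          · intro l _ hl; simp [hE, hl]
          · simp
        have hre : (G j j).im = 0 := by
          rw [← hG.coe_re_apply_self j]; simp
        rw [hvd, hrow, trace, Finset.sum_eq_single j]
        · have : (G * E * Eᴴ).diag j = G j j * ∑ a, d a * star (d a) := by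
            rw [diag_apply, mul_apply, Finset.mul_sum]
            refine Finset.sum_congr rfl fun a _ => ?_
            rw [hGE, conjTranspose_apply, mul_assoc]; simp [hE]
          rw [this, Complex.mul_re, hre]; simp
        · intro i _ hi
          rw [diag_apply, mul_apply]
          exact Finset.sum_eq_zero fun a _ => by simp [hE, hi]
        · simp
      rw [e, trace_add, trace_add, trace_add, Complex.add_re, Complex.add_re, Complex.add_re, e2, e1, e3] at h1
      linarith)
  refine ⟨D, hD, fun a => ?_⟩
  have := congrArg (fun y : EuclideanSpace ℂ κ => y a) h
  simpa using this

lemma exists_eq_mul_conjTranspose {ι : Type*} [Fintype ι] [DecidableEq ι] {Q : Matrix ι ι ℂ}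
    (hQ : Q.PosSemidef) : ∃ V : Matrix ι ι ℂ, Q = V * Vᴴ := by
  refine ⟨(hQ.isHermitian.eigenvectorUnitary : Matrix ι ι ℂ) *
    diagonal (fun i => ((√(hQ.isHermitian.eigenvalues i) : ℝ) : ℂ)), ?_⟩
  have h := add_smul_one_eq hQ.isHermitian 0
  have hd : diagonal (fun i => ((√(hQ.isHermitian.eigenvalues i) : ℝ) : ℂ)) *
      (diagonal (fun i => ((√(hQ.isHermitian.eigenvalues i) : ℝ) : ℂ)))ᴴ
      = diagonal (fun i => ((hQ.isHermitian.eigenvalues i + 0 : ℝ) : ℂ)) := by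
    rw [diagonal_conjTranspose, diagonal_mul_diagonal]
    congr 1; ext i
    simp only [Pi.star_apply, RCLike.star_def, Complex.conj_ofReal, ← Complex.ofReal_mul]
    rw [Real.mul_self_sqrt (hQ.eigenvalues_nonneg i), add_zero]
  rw [Complex.ofReal_zero, zero_smul, add_zero, ← hd] at h
  conv_lhs => rw [h]
  rw [conjTranspose_mul]
  simp only [Matrix.mul_assoc]

/-- Two maximizers of the linear functional `tr (G ·)` under diagonal constraints that agree
after compression by `G` are equal. -/
lemma eq_of_linear_maximizers {ι : Type*} [Fintype ι] [DecidableEq ι] {G : Matrix ι ι ℂ}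
    (hG : G.IsHermitian) {p : ι → ℝ} (hGp : ∀ j, 0 < p j → 0 < (G j j).re) {Y Z : Matrix ι ι ℂ}
    (hY : Y.PosSemidef) (hZ : Z.PosSemidef) (hYp : ∀ j, (Y j j).re = p j)
    (hZp : ∀ j, (Z j j).re = p j)
    (hYmax : ∀ R : Matrix ι ι ℂ, R.PosSemidef → (∀ j, (R j j).re ≤ p j) →
      (G * R).trace.re ≤ (G * Y).trace.re)
    (hZmax : ∀ R : Matrix ι ι ℂ, R.PosSemidef → (∀ j, (R j j).re ≤ p j) →
      (G * R).trace.re ≤ (G * Z).trace.re)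
    (hYZ : G * Y * G = G * Z * G) : Y = Z := by
  obtain ⟨A, hA⟩ := exists_eq_mul_conjTranspose hY
  obtain ⟨B, hB⟩ := exists_eq_mul_conjTranspose hZ
  -- Factors of Y and Z are placed side by side because Y + Z is a maximizer for the budgets 2p. One
  -- multiplier per row then serves both matrices.
  have hsum : fromCols A B * (fromCols A B)ᴴ = Y + Z := by
    rw [conjTranspose_fromCols_eq_fromRows_conjTranspose, fromCols_mul_fromRows, hA, hB]
  have hmult : ∀ j, 0 < p j → ∃ D : ℝ, 0 < D ∧ (∀ k, (G * Y) j k = D * Y j k) ∧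
      ∀ k, (G * Z) j k = D * Z j k := by
    intro j hj
    obtain ⟨D, hD, h⟩ := exists_row_multiplier (p := fun j => 2 * p j) hG (V := fromCols A B)
      (fun j => by rw [hsum, Matrix.add_apply, Complex.add_re, hYp, hZp]; ring)
      (fun R hR hRp => by
        have hR' : ((1 / 2 : ℝ) • R).PosSemidef := posSemidef_real_smul hR (by norm_num)
        have hRp' : ∀ j, (((1 / 2 : ℝ) • R) j j).re ≤ p j := fun j => by
          rw [Matrix.smul_apply, Complex.smul_re, smul_eq_mul]; linarith [hRp j]
        have h1 := hYmax _ hR' hRp'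
        have h2 := hZmax _ hR' hRp'
        rw [mul_smul_comm, trace_smul, Complex.smul_re, smul_eq_mul] at h1 h2
        rw [hsum, mul_add, trace_add, Complex.add_re]
        linarith) (j := j) (by linarith) (hGp j hj)
    rw [mul_fromCols] at h
    refine ⟨D, hD, fun k => ?_, fun k => ?_⟩
    · rw [hA, ← Matrix.mul_assoc, mul_apply, mul_apply, Finset.mul_sum]
      refine Finset.sum_congr rfl fun a _ => ?_
      have := h (Sum.inl a)
      simp only [fromCols_apply_inl] at this
      rw [this]; ring
    · rw [hB, ← Matrix.mul_assoc, mul_apply, mul_apply, Finset.mul_sum]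
      refine Finset.sum_congr rfl fun a _ => ?_
      have := h (Sum.inr a)
      simp only [fromCols_apply_inr] at this
      rw [this]; ring
  have hzero : ∀ {Q : Matrix ι ι ℂ}, Q.PosSemidef → (∀ j, (Q j j).re = p j) → ∀ j k,
      ¬ 0 < p j ∨ ¬ 0 < p k → Q j k = 0 := by
    intro Q hQ hQp j k hjk
    have h0 : ∀ j, ¬ 0 < p j → p j = 0 := fun j hj =>
      le_antisymm (not_lt.1 hj) (hQp j ▸ diag_re_nonneg hQ j)
    have h := norm_entry_sq_le hQ j k
    rw [hQp, hQp] at h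
    have h' : p j * p k = 0 := by
      rcases hjk with h | h
      · rw [h0 j h, zero_mul]
      · rw [h0 k h, mul_zero]
    rw [h'] at h
    exact norm_eq_zero.1 (pow_eq_zero_iff two_ne_zero |>.1 (le_antisymm h (sq_nonneg _)))
  -- The entries of G Q G are those of Q times positive products of row multipliers, so they can be
  -- divided out.
  have hpos : ∀ {Q : Matrix ι ι ℂ}, Q.IsHermitian → ∀ {j k} {a b : ℝ},
      (∀ l, (G * Q) j l = a * Q j l) → (∀ l, (G * Q) k l = b * Q k l) →
      (G * Q * G) j k = a * b * Q j k := by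
    intro Q hQ j k a b ha hb
    have h1 : (G * Q * G) j k = a * (Q * G) j k := by
      rw [mul_apply, mul_apply, Finset.mul_sum]
      exact Finset.sum_congr rfl fun l _ => by rw [ha]; ring
    have h2 : (Q * G) j k = star ((G * Q) k j) := by
      rw [← conjTranspose_apply, conjTranspose_mul, hQ.eq, hG.eq]
    rw [h1, h2, hb, star_mul', hQ.apply]
    simp [mul_assoc]
  ext j k
  by_cases hj : 0 < p j
  · by_cases hk : 0 < p k
    · obtain ⟨a, ha, hYa, hZa⟩ := hmult j hj
      obtain ⟨b, hb, hYb, hZb⟩ := hmult k hk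
      have h1 := hpos hY.isHermitian hYa hYb
      have h2 := hpos hZ.isHermitian hZa hZb
      rw [hYZ, h2] at h1
      have : (a : ℂ) * b ≠ 0 := by exact_mod_cast (mul_pos ha hb).ne'
      exact (mul_left_cancel₀ this h1).symm
    · rw [hzero hY hYp j k (Or.inr hk), hzero hZ hZp j k (Or.inr hk)]
  · rw [hzero hY hYp j k (Or.inl hj), hzero hZ hZp j k (Or.inl hj)]

section

variable {H : Fin K → Matrix (Fin m) (Fin n) ℂ} {P : Fin K → Fin n → ℝ} {i : Fin K}
  {Q : Fin K → Matrix (Fin n) (Fin n) ℂ}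

lemma gram_diag_re_pos {S : Matrix (Fin m) (Fin m) ℂ} (hS : S.PosDef) {A : Matrix (Fin m) (Fin n) ℂ}
    {j : Fin n} (hj : ∃ r, A r j ≠ 0) : 0 < ((Aᴴ * S * A) j j).re := by
  obtain ⟨r, hr⟩ := hj
  have hx : (fun r => A r j) ≠ 0 := fun h => hr (congrFun h r)
  have h := hS.dotProduct_mulVec_pos hx
  have e : (Aᴴ * S * A) j j = star (fun r => A r j) ⬝ᵥ (S *ᵥ fun r => A r j) := by
    rw [Matrix.mul_assoc, mul_apply]; rfl
  rw [e]
  exact (Complex.lt_def.1 h).1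

lemma trace_inv_mul_eq (S : Matrix (Fin m) (Fin m) ℂ) (A : Matrix (Fin m) (Fin n) ℂ)
    (R : Matrix (Fin n) (Fin n) ℂ) :
    (S⁻¹ * (A * R * Aᴴ)).trace = (Aᴴ * S⁻¹ * A * R).trace := by
  rw [← Matrix.mul_assoc, trace_mul_comm]
  simp only [Matrix.mul_assoc]

/-- At a block-optimal point, antennas with a nonzero channel vector use their whole budget. -/
lemma IsBlockOptimal.diag_eq (h : IsBlockOptimal H P i Q) (hQ : Q ∈ feasibleSet P)
    (hcol : ∀ j, 0 < P i j → ∃ r, H i r j ≠ 0) (j : Fin n) : (Q i j j).re = P i j := by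
  have hS := posDef_totalCov H fun k => (hQ k).1
  have h0 := diag_re_nonneg (hQ i).1 j
  refine le_antisymm ((hQ i).2 j) ?_
  by_contra hlt
  push Not at hlt
  have hgap : 0 < P i j - (Q i j j).re := by linarith
  set e : ℝ := P i j - (Q i j j).re with he
  -- Giving antenna j its unused power e would raise the rate to first order by e·G_jj > 0.
  have hD : (diagonal (Pi.single j (e : ℂ)) : Matrix (Fin n) (Fin n) ℂ).PosSemidef := by
    apply PosSemidef.diagonal
    intro k
    by_cases hk : k = j
    · subst hk; simpa using hgap.le
    · simp [hk]
  have hadm : IsAdmissible (P i) (Q i + diagonal (Pi.single j (e : ℂ))) := by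
    refine ⟨(hQ i).1.add hD, fun k => ?_⟩
    by_cases hk : k = j
    · subst hk; simp [he]
    · simpa [hk] using (hQ i).2 k
  have h1 := h.trace_le_zero hQ hadm
  rw [add_sub_cancel_left, trace_inv_mul_eq, trace, Finset.sum_eq_single j] at h1
  · rw [diag_apply, mul_diagonal, Pi.single_eq_same, Complex.re_mul_ofReal] at h1
    have h2 := gram_diag_re_pos hS.inv (hcol j (by linarith))
    have := mul_pos h2 hgap
    linarith
  · intro k _ hk
    simp [mul_diagonal, hk]
  · simp

lemma IsBlockOptimal.trace_gram_le (h : IsBlockOptimal H P i Q) (hQ : Q ∈ feasibleSet P)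
    {R : Matrix (Fin n) (Fin n) ℂ} (hR : R.PosSemidef) (hRp : ∀ j, (R j j).re ≤ P i j) :
    ((H i)ᴴ * (totalCov H Q)⁻¹ * H i * R).trace.re
      ≤ ((H i)ᴴ * (totalCov H Q)⁻¹ * H i * Q i).trace.re := by
  have h1 := h.trace_le_zero hQ ⟨hR, hRp⟩
  rw [trace_inv_mul_eq, Matrix.mul_sub, trace_sub, Complex.sub_re] at h1
  linarith

/-- Optimal tuples are determined by the received covariances of the single users. -/
lemma IsSumRateOptimal.eq_of_received_eq {Y Z : Fin K → Matrix (Fin n) (Fin n) ℂ}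
    (hY : IsSumRateOptimal H P Y) (hZ : IsSumRateOptimal H P Z)
    (hcol : ∀ i j, 0 < P i j → ∃ r, H i r j ≠ 0)
    (hYZ : ∀ i, H i * Y i * (H i)ᴴ = H i * Z i * (H i)ᴴ) : Y = Z := by
  have hS : totalCov H Y = totalCov H Z := by simp only [totalCov, hYZ]
  have hpd := posDef_totalCov H fun k => (hY.1 k).1
  ext1 i
  refine eq_of_linear_maximizers (G := (H i)ᴴ * (totalCov H Y)⁻¹ * H i) (p := P i)
    (isHermitian_conjTranspose_mul_mul _ hpd.inv.isHermitian)
    (fun j hj => gram_diag_re_pos hpd.inv (hcol i j hj)) (hY.1 i).1 (hZ.1 i).1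
    ((hY.isBlockOptimal i).diag_eq hY.1 (hcol i)) ((hZ.isBlockOptimal i).diag_eq hZ.1 (hcol i))
    (fun R hR hRp => (hY.isBlockOptimal i).trace_gram_le hY.1 hR hRp)
    (fun R hR hRp => by rw [hS]; exact (hZ.isBlockOptimal i).trace_gram_le hZ.1 hR hRp) ?_
  -- G Q G involves Q only through the received covariance H_i Q H_i†.
  have e : ∀ Q : Matrix (Fin n) (Fin n) ℂ,
      ((H i)ᴴ * (totalCov H Y)⁻¹ * H i) * Q * ((H i)ᴴ * (totalCov H Y)⁻¹ * H i)
        = (H i)ᴴ * (totalCov H Y)⁻¹ * (H i * Q * (H i)ᴴ) * ((totalCov H Y)⁻¹ * H i) := fun Q => by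
    simp only [Matrix.mul_assoc]
  rw [e, e, hYZ]

lemma totalCov_sub_eq_sum (H : Fin K → Matrix (Fin m) (Fin n) ℂ)
    (Q R : Fin K → Matrix (Fin n) (Fin n) ℂ) :
    totalCov H R - totalCov H Q = ∑ i, H i * (R i - Q i) * (H i)ᴴ := by
  simp only [totalCov, Matrix.mul_sub, Matrix.sub_mul, Finset.sum_sub_distrib]
  abel

/-- Quadratic growth away from the optimum: the first-order term splits over the users and each part
is nonpositive. In particular all optimal tuples share one received covariance. -/
lemma exists_totalCov_sub_sq_le (H : Fin K → Matrix (Fin m) (Fin n) ℂ) (P : Fin K → Fin n → ℝ) :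
    ∃ κ : ℝ, 0 < κ ∧ ∀ Y, IsSumRateOptimal H P Y → ∀ Q ∈ feasibleSet P,
      κ * ‖totalCov H Q - totalCov H Y‖ ^ 2 ≤ sumRate H Y - sumRate H Q := by
  obtain ⟨κ, hκ, h⟩ := exists_strong_concavity H P
  refine ⟨κ, hκ, fun Y hY Q hQ => ?_⟩
  have h1 := h Y hY.1 Q hQ
  have h2 : ((totalCov H Y)⁻¹ * (totalCov H Q - totalCov H Y)).trace.re ≤ 0 := by
    rw [totalCov_sub_eq_sum, Finset.mul_sum, trace_sum, Complex.re_sum]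
    exact Finset.sum_nonpos fun i _ => (hY.isBlockOptimal i).trace_le_zero hY.1 (hQ i)
  linarith

lemma posSemidef_blockDiagonal {Q : Fin K → Matrix (Fin n) (Fin n) ℂ}
    (hQ : ∀ i, (Q i).PosSemidef) : (blockDiagonal Q).PosSemidef := by
  choose V hV using fun i => exists_eq_mul_conjTranspose (hQ i)
  have : blockDiagonal Q = blockDiagonal V * (blockDiagonal V)ᴴ := by
    rw [blockDiagonal_conjTranspose, ← blockDiagonal_mul]
    congr 1; ext1 i; exact hV i
  rw [this]
  exact posSemidef_self_mul_conjTranspose _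

/-- Hölder error bound for the set of optimal covariance tuples. -/
lemma exists_near_isSumRateOptimal (H : Fin K → Matrix (Fin m) (Fin n) ℂ) {P : Fin K → Fin n → ℝ}
    (hcol : ∀ i j, 0 < P i j → ∃ r, H i r j ≠ 0) {Y : Fin K → Matrix (Fin n) (Fin n) ℂ}
    (hY : IsSumRateOptimal H P Y) :
    ∃ C γ : ℝ, 0 ≤ C ∧ 0 < γ ∧ γ ≤ 1 ∧ ∀ Q ∈ feasibleSet P, (∀ i j, (Q i j j).re = P i j) →
      ∃ Z, IsSumRateOptimal H P Z ∧ ‖Z - Q‖ ≤ C * (sumRate H Y - sumRate H Q) ^ γ := by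
  -- The tuple is treated as one block-diagonal matrix. The system prescribes the received
  -- covariance and all diagonals; off-diagonal blocks are free and are discarded at the end by
  -- `blockDiag`.
  let A : Matrix (Fin n × Fin K) (Fin n × Fin K) ℂ →ₗ[ℝ]
      Matrix (Fin m) (Fin m) ℂ × (Fin K → Fin n → ℝ) :=
    { toFun := fun B => (∑ i, H i * blockDiag B i * (H i)ᴴ, fun i j => (B (j, i) (j, i)).re)
      map_add' := fun B B' => by
        ext1
        · simp [blockDiag_add, Matrix.mul_add, Matrix.add_mul, Finset.sum_add_distrib]
        · ext i j; simp
      map_smul' := fun c B => by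
        ext1
        · simp [blockDiag_smul, Finset.smul_sum]
        · ext i j; simp }
  have hA1 : ∀ B, (A B).1 = ∑ i, H i * blockDiag B i * (H i)ᴴ := fun B => rfl
  have hA2 : ∀ B i j, (A B).2 i j = (B (j, i) (j, i)).re := fun B i j => rfl
  have hYdiag : ∀ i j, (Y i j j).re = P i j := fun i =>
    (hY.isBlockOptimal i).diag_eq hY.1 (hcol i)
  obtain ⟨κ, hκ, hres⟩ := exists_totalCov_sub_sq_le H P
  obtain ⟨C, γ, hC, hγ, hγ1, hbound⟩ := exists_holder_error_bound _ (Fin n × Fin K) rfl A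
    (blockDiagonal Y) (posSemidef_blockDiagonal fun i => (hY.1 i).1) (∑ x : Fin n × Fin K, P x.2 x.1)
  let T : Matrix (Fin n × Fin K) (Fin n × Fin K) ℂ →ₗ[ℝ] Fin K → Matrix (Fin n) (Fin n) ℂ :=
    { toFun := blockDiag
      map_add' := blockDiag_add
      map_smul' := blockDiag_smul }
  obtain ⟨d, hd, hT⟩ := T.exists_pos_bound
  -- With full diagonals the residual is the error in the received covariance, at most (gap/κ)^(1/2)
  -- by quadratic growth; hence the halved exponent.
  refine ⟨d * C * (κ⁻¹ ^ (1 / 2 : ℝ)) ^ γ, 1 / 2 * γ, by positivity, by positivity, by linarith,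
    fun Q hQ hQdiag => ?_⟩
  have hQps : (blockDiagonal Q).PosSemidef := posSemidef_blockDiagonal fun i => (hQ i).1
  have hQn : ‖blockDiagonal Q‖ ≤ ∑ x : Fin n × Fin K, P x.2 x.1 := by
    refine (norm_le_trace hQps).trans (le_of_eq ?_)
    simp only [trace, diag_apply, Complex.re_sum]
    exact Finset.sum_congr rfl fun x _ => by rw [blockDiagonal_apply_eq, hQdiag]
  obtain ⟨B, hB, hAB, hBn⟩ := hbound _ hQps hQn
  have hBdiag : ∀ i j, (blockDiag B i j j).re = P i j := fun i j => by
    rw [blockDiag_apply, ← hA2, hAB, hA2, blockDiagonal_apply_eq, hYdiag]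
  have hBcov : totalCov H (blockDiag B) = totalCov H Y := by
    have := congrArg Prod.fst hAB
    rw [hA1, hA1, blockDiag_blockDiagonal] at this
    rw [totalCov, totalCov, this]
  have hBfeas : blockDiag B ∈ feasibleSet P := fun i =>
    ⟨hB.submatrix fun j => (j, i), fun j => (hBdiag i j).le⟩
  refine ⟨blockDiag B, ⟨hBfeas, fun R hR => ?_⟩, ?_⟩
  · rw [sumRate_eq_logDet H (blockDiag B), hBcov]; exact hY.2 R hR
  have hresid : ‖A (blockDiagonal Q) - A (blockDiagonal Y)‖ = ‖totalCov H Q - totalCov H Y‖ := by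
    have : A (blockDiagonal Q) - A (blockDiagonal Y) = (totalCov H Q - totalCov H Y, 0) := by
      ext1
      · rw [Prod.fst_sub, hA1, hA1, blockDiag_blockDiagonal, blockDiag_blockDiagonal, totalCov,
          totalCov, add_sub_add_left_eq_sub]
      · ext i j
        rw [Prod.snd_sub, Pi.sub_apply, Pi.sub_apply, hA2, hA2, blockDiagonal_apply_eq,
          blockDiagonal_apply_eq, hQdiag, hYdiag, sub_self]; rfl
    rw [this, Prod.norm_mk, norm_zero, max_eq_left (norm_nonneg _)]
  have hgap0 : 0 ≤ sumRate H Y - sumRate H Q := sub_nonneg.2 (hY.2 Q hQ)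
  have hrle : ‖totalCov H Q - totalCov H Y‖
      ≤ κ⁻¹ ^ (1 / 2 : ℝ) * (sumRate H Y - sumRate H Q) ^ (1 / 2 : ℝ) := by
    rw [← Real.mul_rpow (by positivity) hgap0, ← Real.sqrt_eq_rpow]
    apply Real.le_sqrt_of_sq_le
    rw [inv_mul_eq_div, le_div_iff₀ hκ, mul_comm]
    exact hres Y hY Q hQ
  have hTQ : blockDiag B - Q = T (B - blockDiagonal Q) := by
    rw [map_sub]; exact congrArg (blockDiag B - ·) (blockDiag_blockDiagonal Q).symm
  calc ‖blockDiag B - Q‖ ≤ d * ‖B - blockDiagonal Q‖ := by rw [hTQ]; exact hT _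
    _ ≤ d * (C * (κ⁻¹ ^ (1 / 2 : ℝ) * (sumRate H Y - sumRate H Q) ^ (1 / 2 : ℝ)) ^ γ) := by
        rw [norm_sub_rev]
        gcongr
        refine hBn.trans ?_
        rw [hresid]
        gcongr
    _ = _ := by
        rw [Real.mul_rpow (by positivity) (by positivity), ← Real.rpow_mul hgap0]
        ring

end

end OptimalSet

/-! ### Finite length from a Łojasiewicz-type inequality -/

section Convergence

open scoped Matrix.Norms.Frobenius

/-- Finite length from sufficient decrease and a Łojasiewicz-type inequality. -/
lemma summable_of_sufficient_decrease {u b : ℕ → ℝ} {κ c γ : ℝ} (hu : ∀ s, 0 ≤ u s)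
    (hb : ∀ s, 0 ≤ b s) (hκ : 0 < κ) (hc : 0 ≤ c) (hγ : 0 < γ) (hγ1 : γ ≤ 1)
    (hdec : ∀ s, κ * b s ^ 2 ≤ u s - u (s + 1)) (hgap : ∀ s, u (s + 1) ≤ c * b s * u (s + 1) ^ γ) :
    Summable b := by
  set M := c / (κ * γ) with hM
  have hM0 : 0 ≤ M := by positivity
  have hstep : ∀ s, b (s + 1) ≤ 1 / 2 * (b s + M * (u (s + 1) ^ γ - u (s + 2) ^ γ)) := by
    intro s
    have hd := hdec (s + 1)
    have hg := hgap s
    set x := u (s + 1) with hx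
    set y := u (s + 2) with hy
    have hx0 : 0 ≤ x := hu _
    have hy0 : 0 ≤ y := hu _
    have hyx : y ≤ x := by
      have : 0 ≤ κ * b (s + 1) ^ 2 := by positivity
      linarith
    have hφ : 0 ≤ x ^ γ - y ^ γ := sub_nonneg.2 (Real.rpow_le_rpow hy0 hyx hγ.le)
    -- Concavity of t ↦ t^γ (Bernoulli) gives γ(x - y) ≤ x^(1-γ)(x^γ - y^γ), and x^(1-γ) ≤ c·b_s by
    -- the gap hypothesis.
    have hkey : γ * (x - y) ≤ c * b s * (x ^ γ - y ^ γ) := by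
      rcases hx0.eq_or_lt with h0 | h0
      · have : y = 0 := le_antisymm (by linarith) hy0
        rw [this, ← h0]; simp
      · have hbern := rpow_one_add_le_one_add_mul_self (s := (y - x) / x) (p := γ)
          (by rw [le_div_iff₀ h0]; linarith) hγ.le hγ1
        have e : 1 + (y - x) / x = y / x := by field_simp; ring
        rw [e, Real.div_rpow hy0 hx0, div_le_iff₀ (by positivity)] at hbern
        have h1 : γ * (x - y) * x ^ γ ≤ x * (x ^ γ - y ^ γ) := by
          have h2 := mul_le_mul_of_nonneg_left hbern hx0
          have e2 : x * ((1 + γ * ((y - x) / x)) * x ^ γ) = x * x ^ γ + γ * (y - x) * x ^ γ := by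
            field_simp
          rw [e2] at h2
          linarith
        have h3 : x * (x ^ γ - y ^ γ) ≤ c * b s * (x ^ γ - y ^ γ) * x ^ γ := by
          calc _ ≤ c * b s * x ^ γ * (x ^ γ - y ^ γ) := by gcongr
            _ = _ := by ring
        exact le_of_mul_le_mul_right (h1.trans h3) (by positivity)
    have hsq : b (s + 1) ^ 2 ≤ b s * (M * (x ^ γ - y ^ γ)) := by
      have h1 : κ * γ * b (s + 1) ^ 2 ≤ c * b s * (x ^ γ - y ^ γ) := by nlinarith
      rw [hM]
      have e : b s * (c / (κ * γ) * (x ^ γ - y ^ γ)) = c * b s * (x ^ γ - y ^ γ) / (κ * γ) := by ring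
      rw [e, le_div_iff₀ (by positivity)]
      linarith
    have h4 : 0 ≤ M * (x ^ γ - y ^ γ) := by positivity
    apply le_of_sq_le_sq _ (by have := hb s; positivity)
    nlinarith [sq_nonneg (b s - M * (x ^ γ - y ^ γ))]
  rw [← summable_nat_add_iff 1]
  -- By the arithmetic-geometric mean, each term is at most half its predecessor plus a telescoping
  -- part. Half of the sum is absorbed on the left.
  refine summable_of_sum_range_le (c := b 0 + M * u 1 ^ γ) (fun s => hb _) fun N => ?_
  have h1 : ∑ s ∈ Finset.range N, b (s + 1)
      ≤ 1 / 2 * (∑ s ∈ Finset.range N, b s + M * (u 1 ^ γ - u (N + 1) ^ γ)) := by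
    have htel := Finset.sum_range_sub' (fun s => u (s + 1) ^ γ) N
    rw [zero_add] at htel
    rw [← htel, Finset.mul_sum, ← Finset.sum_add_distrib, Finset.mul_sum]
    exact Finset.sum_le_sum fun s _ => hstep s
  have h2 : ∑ s ∈ Finset.range N, b s ≤ b 0 + ∑ s ∈ Finset.range N, b (s + 1) := by
    rw [add_comm, ← Finset.sum_range_succ']
    exact Finset.sum_le_sum_of_subset_of_nonneg (Finset.range_mono (Nat.le_succ N)) fun s _ _ => hb s
  have h3 : 0 ≤ M * u (N + 1) ^ γ := mul_nonneg hM0 (Real.rpow_nonneg (hu _) _)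
  linarith

variable {K m n : ℕ}

/-- By S⁻¹ - T⁻¹ = S⁻¹(T - S)T⁻¹. It compares the gradient at the end of a sweep with the gradient
just after a user's own update. -/
lemma trace_inv_sub_inv_mul_le {S T : Matrix (Fin m) (Fin m) ℂ} (hS : S.PosDef) (hT : T.PosDef)
    {b : ℝ} (hSb : ‖S⁻¹‖ ≤ b) (hTb : ‖T⁻¹‖ ≤ b) (D : Matrix (Fin m) (Fin m) ℂ) :
    (S⁻¹ * D).trace.re ≤ (T⁻¹ * D).trace.re + m * b ^ 2 * ‖S - T‖ * ‖D‖ := by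
  have hdS : IsUnit S.det := (isUnit_iff_isUnit_det S).1 hS.isUnit
  have hdT : IsUnit T.det := (isUnit_iff_isUnit_det T).1 hT.isUnit
  have hb : 0 ≤ b := (norm_nonneg _).trans hSb
  have e : S⁻¹ - T⁻¹ = S⁻¹ * (T - S) * T⁻¹ := by
    rw [mul_sub, sub_mul, nonsing_inv_mul _ hdS, one_mul, mul_nonsing_inv_cancel_right _ _ hdT]
  have h1 : ‖S⁻¹ - T⁻¹‖ ≤ b ^ 2 * ‖S - T‖ := by
    rw [e]
    calc _ ≤ ‖S⁻¹ * (T - S)‖ * ‖T⁻¹‖ := frobenius_norm_mul _ _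
      _ ≤ (‖S⁻¹‖ * ‖T - S‖) * ‖T⁻¹‖ := by gcongr; exact frobenius_norm_mul _ _
      _ ≤ (b * ‖T - S‖) * b := by gcongr
      _ = _ := by rw [norm_sub_rev]; ring
  have h2 : ((S⁻¹ - T⁻¹) * D).trace.re ≤ m * (b ^ 2 * ‖S - T‖ * ‖D‖) :=
    (le_abs_self _).trans ((abs_trace_mul_re_le _ _).trans (by gcongr))
  rw [sub_mul, trace_sub, Complex.sub_re] at h2
  linarith

/-! ### Runs of iterative mode-dropping -/

variable {H : Fin K → Matrix (Fin m) (Fin n) ℂ} {P : Fin K → Fin n → ℝ}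
  {X : ℕ → Fin K → Matrix (Fin n) (Fin n) ℂ}

lemma IsIterativeModeDropping.exists_isUserUpdate (hX : IsIterativeModeDropping H P X) (hK : 0 < K)
    (t : ℕ) : ∃ i, IsUserUpdate H P i (X t) (X (t + 1)) := by
  refine ⟨⟨t % K, Nat.mod_lt _ hK⟩, ?_⟩
  have := hX.step (t / K) ⟨t % K, Nat.mod_lt _ hK⟩
  simpa [Nat.div_add_mod'] using this

lemma IsIterativeModeDropping.mem_feasibleSet (hX : IsIterativeModeDropping H P X) (hK : 0 < K)
    (t : ℕ) : X t ∈ feasibleSet P := by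
  induction t with
  | zero => exact hX.init
  | succ t ih =>
    obtain ⟨i, hi⟩ := hX.exists_isUserUpdate hK t
    exact hi.mem_feasibleSet ih

/-- The change of the received covariance in one step. -/
noncomputable def stepNorm (H : Fin K → Matrix (Fin m) (Fin n) ℂ)
    (X : ℕ → Fin K → Matrix (Fin n) (Fin n) ℂ) (t : ℕ) : ℝ :=
  ‖totalCov H (X (t + 1)) - totalCov H (X t)‖

/-- The length of the path of the received covariance during a sweep. -/
noncomputable def sweepNorm (H : Fin K → Matrix (Fin m) (Fin n) ℂ)
    (X : ℕ → Fin K → Matrix (Fin n) (Fin n) ℂ) (s : ℕ) : ℝ :=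
  ∑ r ∈ Finset.range K, stepNorm H X (s * K + r)

lemma stepNorm_nonneg (H : Fin K → Matrix (Fin m) (Fin n) ℂ)
    (X : ℕ → Fin K → Matrix (Fin n) (Fin n) ℂ) (t : ℕ) : 0 ≤ stepNorm H X t := norm_nonneg _

lemma sweepNorm_nonneg (H : Fin K → Matrix (Fin m) (Fin n) ℂ)
    (X : ℕ → Fin K → Matrix (Fin n) (Fin n) ℂ) (s : ℕ) : 0 ≤ sweepNorm H X s :=
  Finset.sum_nonneg fun _ _ => stepNorm_nonneg H X _

/-- Strong concavity is expanded at the new point, where block optimality makes the slope towards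
the old point nonpositive. -/
lemma IsIterativeModeDropping.exists_ascent (hX : IsIterativeModeDropping H P X) (hK : 0 < K) :
    ∃ κ : ℝ, 0 < κ ∧ ∀ t, κ * stepNorm H X t ^ 2 ≤ sumRate H (X (t + 1)) - sumRate H (X t) := by
  obtain ⟨κ, hκ, h⟩ := exists_strong_concavity H P
  refine ⟨κ, hκ, fun t => ?_⟩
  obtain ⟨i, hi⟩ := hX.exists_isUserUpdate hK t
  have hf := hX.mem_feasibleSet hK t
  have hf' := hX.mem_feasibleSet hK (t + 1)
  have h1 := h _ hf' _ hf
  have hblock := hi.isBlockOptimal hf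
  have e : totalCov H (X t) - totalCov H (X (t + 1)) = H i * (X t i - X (t + 1) i) * (H i)ᴴ := by
    have e1 : X t = Function.update (X (t + 1)) i (X t i) := by
      conv_rhs => rw [hi.eq_update]
      rw [Function.update_idem, Function.update_eq_self]
    conv_lhs => rw [e1, totalCov_update_sub]
    abel
  have h2 := hblock.trace_le_zero hf' (hf i)
  rw [← e] at h2
  rw [stepNorm, norm_sub_rev]
  linarith

lemma IsIterativeModeDropping.monotone_sumRate (hX : IsIterativeModeDropping H P X) :
    Monotone fun t => sumRate H (X t) := by
  rcases Nat.eq_zero_or_pos K with rfl | hK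
  -- Without users the step condition is void, but there is only one tuple.
  · exact fun s t _ => le_of_eq (congrArg (sumRate H) (Subsingleton.elim (X s) (X t)))
  · obtain ⟨κ, hκ, h⟩ := hX.exists_ascent hK
    refine monotone_nat_of_le_succ fun t => ?_
    have := h t
    have : 0 ≤ κ * stepNorm H X t ^ 2 := by positivity
    linarith

lemma IsIterativeModeDropping.exists_sweep_ascent (hX : IsIterativeModeDropping H P X) (hK : 0 < K) :
    ∃ κ : ℝ, 0 < κ ∧ ∀ s, κ * sweepNorm H X s ^ 2
      ≤ sumRate H (X ((s + 1) * K)) - sumRate H (X (s * K)) := by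
  obtain ⟨κ, hκ, h⟩ := hX.exists_ascent hK
  have hK' : (0 : ℝ) < K := by exact_mod_cast hK
  refine ⟨κ / K, by positivity, fun s => ?_⟩
  have h1 : sweepNorm H X s ^ 2 ≤ K * ∑ r ∈ Finset.range K, stepNorm H X (s * K + r) ^ 2 := by
    simpa [sweepNorm] using sq_sum_le_card_mul_sum_sq (s := Finset.range K)
      (f := fun r => stepNorm H X (s * K + r))
  calc κ / K * sweepNorm H X s ^ 2
      ≤ κ / K * (K * ∑ r ∈ Finset.range K, stepNorm H X (s * K + r) ^ 2) := by gcongr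
    _ = ∑ r ∈ Finset.range K, κ * stepNorm H X (s * K + r) ^ 2 := by
        rw [← Finset.mul_sum]; field_simp
    _ ≤ ∑ r ∈ Finset.range K, (sumRate H (X (s * K + (r + 1))) - sumRate H (X (s * K + r))) :=
        Finset.sum_le_sum fun r _ => h _
    _ = _ := by
        rw [Finset.sum_range_sub fun r => sumRate H (X (s * K + r))]
        rw [add_zero, add_mul, one_mul]

lemma IsIterativeModeDropping.block_eq_after_update (hX : IsIterativeModeDropping H P X) (s : ℕ)
    (i : Fin K) : X ((s + 1) * K) i = X (s * K + i + 1) i := by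
  have h : ∀ r, (i : ℕ) + 1 ≤ r → r ≤ K → X (s * K + r) i = X (s * K + i + 1) i := by
    intro r hr
    induction r, hr using Nat.le_induction with
    | base => intro _; rfl
    | succ r hr ih =>
      intro hrK
      rw [← ih (by omega)]
      exact (hX.step s ⟨r, hrK⟩).1 i (fun h => by rw [h] at hr; simp at hr)
  rw [add_mul, one_mul]
  exact h K i.isLt le_rfl

lemma norm_totalCov_sub_le_sweepNorm (H : Fin K → Matrix (Fin m) (Fin n) ℂ)
    (X : ℕ → Fin K → Matrix (Fin n) (Fin n) ℂ) (s : ℕ) {r : ℕ} (hr : r ≤ K) :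
    ‖totalCov H (X ((s + 1) * K)) - totalCov H (X (s * K + r))‖ ≤ sweepNorm H X s := by
  have h := dist_le_Ico_sum_dist (fun r => totalCov H (X (s * K + r))) hr
  rw [dist_comm, dist_eq_norm] at h
  rw [add_mul, one_mul]
  refine h.trans ?_
  calc _ = ∑ r ∈ Finset.Ico r K, stepNorm H X (s * K + r) :=
        Finset.sum_congr rfl fun r _ => by rw [dist_comm, dist_eq_norm]; rfl
    _ ≤ _ := Finset.sum_le_sum_of_subset_of_nonneg
        (fun x hx => Finset.mem_range.2 (Finset.mem_Ico.1 hx).2) fun _ _ _ => stepNorm_nonneg H X _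

/-- The gap after a sweep is bounded by the path length of the sweep times a distance. -/
lemma IsIterativeModeDropping.exists_gap_bound (hX : IsIterativeModeDropping H P X) (hK : 0 < K) :
    ∃ c : ℝ, 0 ≤ c ∧ ∀ s, ∀ Y ∈ feasibleSet P,
      sumRate H Y - sumRate H (X ((s + 1) * K)) ≤ c * sweepNorm H X s * ‖Y - X ((s + 1) * K)‖ := by
  obtain ⟨b, hb, hbd⟩ := exists_bound_totalCov H P
  refine ⟨∑ i, m * b ^ 2 * ‖H i‖ ^ 2, by positivity, fun s Y hY => ?_⟩
  set Q := X ((s + 1) * K) with hQdef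
  have hQ : Q ∈ feasibleSet P := hX.mem_feasibleSet hK _
  have hSpd := posDef_totalCov H fun i => (hQ i).1
  have h1 := logDet_le hSpd (posDef_totalCov H fun i => (hY i).1)
  rw [totalCov_sub_eq_sum, Finset.mul_sum, trace_sum, Complex.re_sum] at h1
  have hterm : ∀ i, ((totalCov H Q)⁻¹ * (H i * (Y i - Q i) * (H i)ᴴ)).trace.re
      ≤ m * b ^ 2 * ‖H i‖ ^ 2 * (sweepNorm H X s * ‖Y - Q‖) := by
    intro i
    have hW : X (s * K + i + 1) ∈ feasibleSet P := hX.mem_feasibleSet hK _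
    have h2 := trace_inv_sub_inv_mul_le hSpd (posDef_totalCov H fun i => (hW i).1)
      (hbd Q hQ).2.2 (hbd _ hW).2.2 (H i * (Y i - Q i) * (H i)ᴴ)
    -- First-order optimality right after the update of user i, whose block is already the one at
    -- the end of the sweep.
    have h3 := ((hX.step s i).isBlockOptimal (hX.mem_feasibleSet hK _)).trace_le_zero hW (hY i)
    rw [← hX.block_eq_after_update s i] at h3
    have h4 : ‖totalCov H Q - totalCov H (X (s * K + i + 1))‖ ≤ sweepNorm H X s :=
      norm_totalCov_sub_le_sweepNorm H X s (r := i + 1) i.isLt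
    have h5 : ‖H i * (Y i - Q i) * (H i)ᴴ‖ ≤ ‖H i‖ ^ 2 * ‖Y - Q‖ := by
      calc _ ≤ ‖H i * (Y i - Q i)‖ * ‖(H i)ᴴ‖ := frobenius_norm_mul _ _
        _ ≤ (‖H i‖ * ‖Y i - Q i‖) * ‖(H i)ᴴ‖ := by gcongr; exact frobenius_norm_mul _ _
        _ ≤ (‖H i‖ * ‖Y - Q‖) * ‖(H i)ᴴ‖ := by gcongr; exact norm_le_pi_norm (Y - Q) i
        _ = _ := by rw [frobenius_norm_conjTranspose]; ring
    calc _ ≤ _ := h2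
      _ ≤ 0 + m * b ^ 2 * sweepNorm H X s * (‖H i‖ ^ 2 * ‖Y - Q‖) := by
          have := sweepNorm_nonneg H X s
          gcongr
      _ = _ := by ring
  rw [sumRate_eq_logDet, sumRate_eq_logDet, mul_assoc, Finset.sum_mul]
  have := Finset.sum_le_sum fun i (_ : i ∈ Finset.univ) => hterm i
  linarith

/-- The rates are monotone and bounded, so their increments and hence `sweepNorm` vanish in the
limit. The gap bound, with a distance of at most 2b, then closes the gap; no condition on the
columns is needed. -/
lemma IsIterativeModeDropping.tendsto_sumRate (hX : IsIterativeModeDropping H P X)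
    {Y : Fin K → Matrix (Fin n) (Fin n) ℂ} (hY : IsSumRateOptimal H P Y) :
    Tendsto (fun t => sumRate H (X t)) atTop (𝓝 (sumRate H Y)) := by
  rcases Nat.eq_zero_or_pos K with rfl | hK
  · have : (fun t => sumRate H (X t)) = fun _ => sumRate H Y := by
      ext1 t; rw [Subsingleton.elim (X t) Y]
    rw [this]; exact tendsto_const_nhds
  have hle : ∀ t, sumRate H (X t) ≤ sumRate H Y := fun t => hY.2 _ (hX.mem_feasibleSet hK t)
  obtain ⟨l, hl⟩ : ∃ l, Tendsto (fun t => sumRate H (X t)) atTop (𝓝 l) :=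
    ⟨_, tendsto_atTop_ciSup hX.monotone_sumRate ⟨_, by rintro _ ⟨t, rfl⟩; exact hle t⟩⟩
  have hmulK : Tendsto (fun s : ℕ => s * K) atTop atTop := tendsto_id.atTop_mul_const' hK
  have hl1 : Tendsto (fun s => sumRate H (X (s * K))) atTop (𝓝 l) := hl.comp hmulK
  have hl2 : Tendsto (fun s => sumRate H (X ((s + 1) * K))) atTop (𝓝 l) :=
    hl1.comp (tendsto_add_atTop_nat 1)
  obtain ⟨κ, hκ, hasc⟩ := hX.exists_sweep_ascent hK
  have hsweep : Tendsto (fun s => sweepNorm H X s) atTop (𝓝 0) := by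
    have h1 : Tendsto (fun s => sweepNorm H X s ^ 2) atTop (𝓝 0) := by
      have h2 : Tendsto (fun s => κ⁻¹ * (sumRate H (X ((s + 1) * K)) - sumRate H (X (s * K))))
          atTop (𝓝 0) := by
        simpa using (hl2.sub hl1).const_mul κ⁻¹
      refine squeeze_zero (fun s => sq_nonneg _) (fun s => ?_) h2
      rw [inv_mul_eq_div, le_div_iff₀ hκ, mul_comm]
      exact hasc s
    have h3 := h1.sqrt
    simpa [Real.sqrt_sq (sweepNorm_nonneg H X _)] using h3
  obtain ⟨c, hc, hgap⟩ := hX.exists_gap_bound hK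
  obtain ⟨b, hb, hbd⟩ := exists_bound_totalCov H P
  have hlim : sumRate H Y - l ≤ c * 0 * (b + b) := by
    refine le_of_tendsto_of_tendsto' (tendsto_const_nhds.sub hl2)
      ((hsweep.const_mul c).mul_const (b + b)) fun s => (hgap s Y hY.1).trans ?_
    have := sweepNorm_nonneg H X s
    gcongr
    exact (norm_sub_le _ _).trans
      (add_le_add (hbd _ hY.1).1 (hbd _ (hX.mem_feasibleSet hK _)).1)
  have hlY : l ≤ sumRate H Y := le_of_tendsto' hl hle
  have : l = sumRate H Y := le_antisymm hlY (by linarith)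
  rwa [this] at hl

lemma IsIterativeModeDropping.diag_eq (hX : IsIterativeModeDropping H P X) (hK : 0 < K)
    (hcol : ∀ i j, 0 < P i j → ∃ r, H i r j ≠ 0) (s : ℕ) (i : Fin K) (j : Fin n) :
    (X ((s + 1) * K) i j j).re = P i j := by
  rw [hX.block_eq_after_update]
  exact ((hX.step s i).isBlockOptimal (hX.mem_feasibleSet hK _)).diag_eq
    (hX.mem_feasibleSet hK _) (hcol i) j

/-- The gap bound is used not at a fixed optimum but at an optimal Z near the current iterate, whose
distance is a power of the gap. The Hölder bound applies since full power is used after every sweep.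
-/
lemma IsIterativeModeDropping.summable_sweepNorm (hX : IsIterativeModeDropping H P X) (hK : 0 < K)
    (hcol : ∀ i j, 0 < P i j → ∃ r, H i r j ≠ 0) : Summable (sweepNorm H X) := by
  obtain ⟨Y, hY⟩ := exists_isSumRateOptimal H ⟨X 0, hX.init⟩
  obtain ⟨κ, hκ, hasc⟩ := hX.exists_sweep_ascent hK
  obtain ⟨c, hc, hgap⟩ := hX.exists_gap_bound hK
  obtain ⟨C, γ, hC, hγ, hγ1, hnear⟩ := exists_near_isSumRateOptimal H hcol hY
  refine summable_of_sufficient_decrease (u := fun s => sumRate H Y - sumRate H (X (s * K)))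
    (c := c * C) (fun s => sub_nonneg.2 (hY.2 _ (hX.mem_feasibleSet hK _)))
    (sweepNorm_nonneg H X) hκ (by positivity) hγ hγ1 (fun s => ?_) (fun s => ?_)
  · have := hasc s
    linarith
  · obtain ⟨Z, hZ, hZn⟩ := hnear _ (hX.mem_feasibleSet hK _) (hX.diag_eq hK hcol s)
    have hYZ : sumRate H Y = sumRate H Z := le_antisymm (hZ.2 _ hY.1) (hY.2 _ hZ.1)
    have h1 := hgap s Z hZ.1
    have := sweepNorm_nonneg H X s
    calc sumRate H Y - sumRate H (X ((s + 1) * K))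
        ≤ c * sweepNorm H X s * ‖Z - X ((s + 1) * K)‖ := by rw [hYZ]; exact h1
      _ ≤ c * sweepNorm H X s * (C * (sumRate H Y - sumRate H (X ((s + 1) * K))) ^ γ) := by gcongr
      _ = _ := by ring

lemma summable_stepNorm (hK : 0 < K) (h : Summable (sweepNorm H X)) : Summable (stepNorm H X) := by
  have hsum : ∀ N, ∑ t ∈ Finset.range (N * K), stepNorm H X t
      = ∑ s ∈ Finset.range N, sweepNorm H X s := by
    intro N
    induction N with
    | zero => simp
    | succ N ih => rw [add_mul, one_mul, Finset.sum_range_add, ih, Finset.sum_range_succ]; rfl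
  refine summable_of_sum_range_le (c := ∑' s, sweepNorm H X s) (stepNorm_nonneg H X) fun N => ?_
  calc _ ≤ ∑ t ∈ Finset.range (N * K), stepNorm H X t :=
        Finset.sum_le_sum_of_subset_of_nonneg (Finset.range_mono (Nat.le_mul_of_pos_right N hK))
          fun t _ _ => stepNorm_nonneg H X t
    _ = _ := hsum N
    _ ≤ _ := h.sum_le_tsum _ fun s _ => sweepNorm_nonneg H X s

/-- The updated user accounts for the whole change of the total, so nothing cancels between users.
-/
lemma IsIterativeModeDropping.dist_received_le (hX : IsIterativeModeDropping H P X) (hK : 0 < K)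
    (t : ℕ) (k : Fin K) :
    dist (H k * X t k * (H k)ᴴ) (H k * X (t + 1) k * (H k)ᴴ) ≤ stepNorm H X t := by
  obtain ⟨i, hi⟩ := hX.exists_isUserUpdate hK t
  by_cases hk : k = i
  · subst hk
    have h := totalCov_update_sub H (X t) k (X (t + 1) k)
    rw [← hi.eq_update] at h
    rw [dist_comm, dist_eq_norm, stepNorm, h, add_sub_cancel_left, Matrix.mul_sub, Matrix.sub_mul]
  · rw [hi.1 k hk, dist_self]
    exact stepNorm_nonneg H X t

lemma IsIterativeModeDropping.exists_tendsto (hX : IsIterativeModeDropping H P X)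
    (hcol : ∀ i j, 0 < P i j → ∃ r, H i r j ≠ 0) :
    ∃ Y, IsSumRateOptimal H P Y ∧ Tendsto X atTop (𝓝 Y) := by
  obtain ⟨W, hW⟩ := exists_isSumRateOptimal H ⟨X 0, hX.init⟩
  rcases Nat.eq_zero_or_pos K with rfl | hK
  · refine ⟨W, hW, ?_⟩
    have : X = fun _ => W := by ext1 t; exact Subsingleton.elim _ _
    rw [this]; exact tendsto_const_nhds
  have hsum := summable_stepNorm hK (hX.summable_sweepNorm hK hcol)
  have hT : ∀ i, ∃ T, Tendsto (fun t => H i * X t i * (H i)ᴴ) atTop (𝓝 T) := fun i =>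
    cauchySeq_tendsto_of_complete
      (cauchySeq_of_dist_le_of_summable _ (fun t => hX.dist_received_le hK t i) hsum)
  choose T hT using hT
  have : FirstCountableTopology (Matrix (Fin n) (Fin n) ℂ) :=
    inferInstanceAs (FirstCountableTopology (Fin n → Fin n → ℂ))
  have hcpt := isCompact_feasibleSet P
  have hmem : ∀ t, X t ∈ feasibleSet P := hX.mem_feasibleSet hK
  -- A cluster point inherits the limiting rate, hence optimality, and the limits of the single
  -- received covariances; these two facts leave only one candidate.
  have hcl : ∀ Y ∈ feasibleSet P, MapClusterPt Y atTop X →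
      IsSumRateOptimal H P Y ∧ ∀ i, H i * Y i * (H i)ᴴ = T i := by
    intro Y hY hc
    obtain ⟨φ, hφ, hφY⟩ := hc.tendsto_subseq
    have hval : sumRate H Y = sumRate H W := by
      have h1 : Tendsto (fun s => sumRate H (X (φ s))) atTop (𝓝 (sumRate H Y)) :=
        (continuousOn_sumRate H P Y hY).tendsto.comp
          (tendsto_nhdsWithin_iff.2 ⟨hφY, Eventually.of_forall fun s => hmem _⟩)
      exact tendsto_nhds_unique h1 ((hX.tendsto_sumRate hW).comp hφ.tendsto_atTop)
    refine ⟨⟨hY, fun R hR => hval ▸ hW.2 R hR⟩, fun i => ?_⟩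
    have h2 : Continuous fun Q : Fin K → Matrix (Fin n) (Fin n) ℂ => H i * Q i * (H i)ᴴ := by
      fun_prop
    exact tendsto_nhds_unique ((h2.tendsto Y).comp hφY) ((hT i).comp hφ.tendsto_atTop)
  obtain ⟨Y, hY, hYc⟩ := hcpt.exists_mapClusterPt (f := atTop) (u := X)
    (tendsto_principal.2 (Eventually.of_forall hmem))
  obtain ⟨hYopt, hYT⟩ := hcl Y hY hYc
  refine ⟨Y, hYopt, hcpt.tendsto_nhds_of_unique_mapClusterPt (Eventually.of_forall hmem) ?_⟩
  intro Z hZ hZc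
  obtain ⟨hZopt, hZT⟩ := hcl Z hZ hZc
  exact hZopt.eq_of_received_eq hYopt hcol fun i => by rw [hZT, hYT]

end Convergence

/-- Convergence of iterative mode-dropping. Part 3 assumes that every transmit antenna with a
non-zero power budget has a non-zero channel vector; parts 1 and 2 hold for all channels. -/
theorem theorem2 {K m n : ℕ} (H : Fin K → Matrix (Fin m) (Fin n) ℂ) (P : Fin K → Fin n → ℝ)
    (hP : ∀ i j, 0 ≤ P i j) (X : ℕ → Fin K → Matrix (Fin n) (Fin n) ℂ)
    (hX : IsIterativeModeDropping H P X) :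
    Monotone (fun t => sumRate H (X t)) ∧
    (∃ C : ℝ, IsSumCapacity H P C ∧ Tendsto (fun t => sumRate H (X t)) atTop (𝓝 C)) ∧
    ((∀ i j, 0 < P i j → ∃ r, H i r j ≠ 0) →
      ∃ Qopt : Fin K → Matrix (Fin n) (Fin n) ℂ, IsSumRateOptimal H P Qopt ∧
        ∀ i, Tendsto (fun t => X t i) atTop (𝓝 (Qopt i))) := by
  refine ⟨hX.monotone_sumRate, ?_, fun hcol => ?_⟩
  · obtain ⟨Y, hY⟩ := exists_isSumRateOptimal H ⟨X 0, hX.init⟩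
    refine ⟨sumRate H Y, ⟨⟨Y, hY.1, rfl⟩, ?_⟩, hX.tendsto_sumRate hY⟩
    rintro _ ⟨R, hR, rfl⟩
    exact hY.2 R hR
  · obtain ⟨Y, hY, hlim⟩ := hX.exists_tendsto hcol
    exact ⟨Y, hY, fun i => (tendsto_pi_nhds.1 hlim) i⟩
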